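/- Let $K$ be a field of characteristic $0$ and let $G$ be an affine group scheme over $K$ (for example, a reductive algebraic group; no condition on $G$ is needed). Let $V$ and $W$ be finite-dimensional rational representations of $G$, and let $P$ be a polynomial functor, that is, a functor from finite-dimensional $K$-vector spaces to finite-dimensional $K$-vector spaces such that for all $U,U'$ the map $\operatorname{Hom}(U,U')\to\operatorname{Hom}(P(U),P(U'))$, $f\mapsto P(f)$, is polynomial; then $P(V)$ is again a rational representation of $G$. Symmetric functions are taken with coefficients in $K$ and completed by degree, so that formal sums $\sum_{d\ge0} f_d$ with $f_d$ symmetric and homogeneous of degree $d$ are allowed. There is exactly one such $\operatorname{ch}P$ with the following property: for every invertible diagonal matrix $D$ over $K$ with diagonal entries $a_1,\dots,a_n$, only finitely many homogeneous components of $\operatorname{ch}P$ are nonzero at $(a_1,\dots,a_n,0,0,\dots)$, and $(\operatorname{ch}P)(a_1,\dots,a_n,0,0,\dots)=\operatorname{Tr}P(D)$. For $r\ge 0$ the symmetric group $\mathfrak S_r$ acts on $\operatorname{Hom}_G(T^r(V),W)$, $T^r(V)=V^{\otimes r}$, by permuting the tensor factors. For a finite-dimensional representation $E$ of $\mathfrak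 S_r$ put $\operatorname{ch}E=\frac1{r!}\sum_{\pi\in\mathfrak S_r}\operatorname{Tr}(\pi|_E)\,p_{\lambda(\pi)}$, where $\lambda(\pi)$ is the cycle type of $\pi$ and $p_\lambda$ is the power sum product, and put $\operatorname{ch}\operatorname{Hom}_G(T^\bullet(V),W)=\sum_{r\ge0}\operatorname{ch}\operatorname{Hom}_G(T^r(V),W)$. Then $$\operatorname{ch}\operatorname{Hom}_G(T^\bullet(P(V)),W)=\bigl\langle H[X\cdot(\operatorname{ch}P)[Y]],\ \operatorname{ch}\operatorname{Hom}_G(T^\bullet(V),W)[Y]\bigr\rangle_Y .$$ Here $H=1+h_1+h_2+\cdots$ is the sum of the complete symmetric functions, $X$ and $Y$ are two alphabets, square brackets denote plethysm, and $\langle\ ,\ \rangle_Y$ is the Hall inner product in the alphabet $Y$ (with values in symmetric functions in $X$), i.e. the sum over $d\ge0$ of the Hall inner products of the components of $Y$-degree $d$. In the coefficient of each $p_\lambda[X]$ only finitely many $d$ contribute, so that the right-hand side is defined. -/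

import Mathlib

open scoped TensorProduct
open CategoryTheory

universe u

namespace TensorInvariants

noncomputable section

/-! ### Symmetric functions

Over a field `K` of characteristic zero the ring of symmetric functions is the polynomial ring
`K[p₁, p₂, p₃, …]` in the power sums, `p_k` having degree `k`.  Its completion by degree (formal
infinite sums of homogeneous symmetric functions) is the power series ring in the `p_k`. -/

/-- The completed ring of symmetric functions over `K` in one alphabet.  The variable with index `k`
is the power sum `p_k`, and an exponent vector `m` stands for the partition
`1^(m 1) 2^(m 2) 3^(m 3) ⋯`. -/
abbrev SymFun (K : Type u) [Field K] : Type u := MvPowerSeries ℕ+ K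

/-- The completed ring of functions that are symmetric in each of two alphabets `X` and `Y`: the
variables `Sum.inl k` and `Sum.inr k` are `p_k[X]` and `p_k[Y]`. -/
abbrev SymXY (K : Type u) [Field K] : Type u := MvPowerSeries (ℕ+ ⊕ ℕ+) K

/-- The exponent vector of a multiset of positive integers (zeros are ignored): the exponent at `k`
is the multiplicity of `k`. -/
def expOf (s : Multiset ℕ) : ℕ+ →₀ ℕ :=
  Finsupp.comapDomain (fun k : ℕ+ => (k : ℕ)) (Multiset.toFinsupp s) PNat.coe_injective.injOn

/-- The size of the partition with exponent vector `m`, which is the degree of the monomial `p^m`. -/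
def size (m : ℕ+ →₀ ℕ) : ℕ := m.sum fun k e => (k : ℕ) * e

/-- `z_λ = ∏ k^(m k) (m k)!` for the partition `λ` with exponent vector `m`. -/
def zee (m : ℕ+ →₀ ℕ) : ℕ := m.prod fun k e => (k : ℕ) ^ e * e.factorial

section

variable {K : Type u} [Field K]

/-- The power sum product `p_λ`, the parts of `λ` being given as a multiset. -/
def pProd (s : Multiset ℕ) : SymFun K := MvPowerSeries.monomial (expOf s) 1

/-- The series `H = 1 + h₁ + h₂ + ⋯`, where `h_n = ∑_{λ ⊢ n} z_λ⁻¹ p_λ`. -/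
def bigH : SymFun K := fun m => ((zee m : ℕ) : K)⁻¹

/-- The sum `∑ r, g r` of symmetric functions `g r` homogeneous of degree `r`. -/
def gradedSum (g : ℕ → SymFun K) : SymFun K := fun m => MvPowerSeries.coeff m (g (size m))

/-- `F ↦ F[Y]`. -/
def inY : SymFun K →ₐ[K] SymXY K := MvPowerSeries.rename (Function.Embedding.inr : ℕ+ ↪ ℕ+ ⊕ ℕ+)

/-- The alphabet `X`, that is, the symmetric function `p₁[X] = h₁[X]`. -/
def alphX : SymXY K := MvPowerSeries.X (Sum.inl 1)

/-- Multiplication by `k`, as an embedding of the positive integers. -/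
def mulEmb (k : ℕ+) : ℕ+ ↪ ℕ+ := ⟨fun n => k * n, mul_right_injective k⟩

/-- Plethysm by a power sum, `Z ↦ p_k[Z]`: the (continuous) algebra endomorphism that takes `p_n[X]`
to `p_{kn}[X]` and `p_n[Y]` to `p_{kn}[Y]`. -/
def pPleth (k : ℕ+) : SymXY K →ₐ[K] SymXY K :=
  MvPowerSeries.rename ((mulEmb k).sumMap (mulEmb k))

/-- Plethysm `f[Z]`: the algebra homomorphism in `f` that takes `p_k` to `p_k[Z]`. -/
def pleth (f : SymFun K) (Z : SymXY K) : SymXY K :=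
  MvPowerSeries.subst (fun k => pPleth k Z) f

/-- The part of Hall's inner product `⟨G, F⟩_Y` that comes from `Y`-degree `d`, as a function of
the exponent vector `m` of a power sum product in the alphabet `X`.  Hall's inner product is the
bilinear form with `⟨p_λ, p_λ⟩ = z_λ` and `⟨p_λ, p_μ⟩ = 0` for `λ ≠ μ`. -/
def hallYPart (G : SymXY K) (F : SymFun K) (m : ℕ+ →₀ ℕ) (d : ℕ) : K :=
  ∑ l : Nat.Partition d,
    ((zee (expOf l.parts) : ℕ) : K) * MvPowerSeries.coeff (m.sumElim (expOf l.parts)) G *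
      MvPowerSeries.coeff (expOf l.parts) F

/-- The inner product `⟨G, F⟩_Y` exists: each of its coefficients receives contributions from only
finitely many degrees. -/
def HallYDefined (G : SymXY K) (F : SymFun K) : Prop :=
  ∀ m : ℕ+ →₀ ℕ, (Function.support (hallYPart G F m)).Finite

/-- Hall's inner product `⟨G[X, Y], F[Y]⟩_Y`, taken in the alphabet `Y` with values in the symmetric
functions in `X`. -/
def hallY (G : SymXY K) (F : SymFun K) : SymFun K := fun m => ∑ᶠ d : ℕ, hallYPart G F m d

/-- The value `f_d(a₁, …, a_n, 0, 0, …)` of the component of degree `d` of `f`. -/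
def evalPart (f : SymFun K) {n : ℕ} (a : Fin n → K) (d : ℕ) : K :=
  ∑ l : Nat.Partition d,
    MvPowerSeries.coeff (expOf l.parts) f * (l.parts.map fun k => ∑ i, a i ^ k).prod

end

/-! ### Polynomial functors -/

section

variable {K : Type u} [Field K]

/-- A functor `P` from finite dimensional vector spaces to themselves is polynomial if each of the
maps `Hom(U, V) → Hom(P U, P V)` is polynomial. -/
def IsPolynomialFunctor (P : FGModuleCat.{u} K ⥤ FGModuleCat.{u} K) : Prop :=
  ∀ U V : FGModuleCat.{u} K, ∃ φ : (U →ₗ[K] V) →ₚₗ[K] (P.obj U →ₗ[K] P.obj V),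
    ∀ f : U ⟶ V, φ.ground f.hom.hom = (P.map f).hom.hom

/-- `f` is the character of `P`: for each invertible diagonal matrix with entries `a₁, …, a_n`,
`f(a₁, …, a_n, 0, 0, …)` (a sum with finitely many nonzero homogeneous terms) is the trace of the
image of that matrix under `P`. -/
def IsCharacter (P : FGModuleCat.{u} K ⥤ FGModuleCat.{u} K) (f : SymFun K) : Prop :=
  ∀ (n : ℕ) (a : Fin n → K), (∀ i, a i ≠ 0) →
    (Function.support (evalPart f a)).Finite ∧
    ∑ᶠ d : ℕ, evalPart f a d =
      LinearMap.trace K (P.obj (FGModuleCat.of K (Fin n → K)))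
        (P.map (FGModuleCat.ofHom (Matrix.toLin' (Matrix.diagonal a)))).hom.hom

/-- The character `ch P` of a polynomial functor, determined by `IsCharacter`. -/
def functorChar (P : FGModuleCat.{u} K ⥤ FGModuleCat.{u} K) : SymFun K :=
  Classical.epsilon (IsCharacter P)

end

/-! ### Rational representations of an affine group

An affine group scheme `G` over `K` is given by its commutative Hopf algebra `A = K[G]`. -/

/-- A rational representation of `G` on `V`: a right comodule structure over `A = K[G]`.  If
`ρ v = ∑ vᵢ ⊗ aᵢ` then `g • v = ∑ aᵢ(g) vᵢ`. -/
structure RationalRep (K A V : Type u) [Field K] [CommRing A] [HopfAlgebra K A]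
    [AddCommGroup V] [Module K V] where
  coact : V →ₗ[K] V ⊗[K] A
  coassoc : (TensorProduct.assoc K V A A).toLinearMap ∘ₗ coact.rTensor A ∘ₗ coact =
    (Coalgebra.comul (R := K) (A := A)).lTensor V ∘ₗ coact
  counit : (TensorProduct.rid K V).toLinearMap ∘ₗ
    (Coalgebra.counit (R := K) (A := A)).lTensor V ∘ₗ coact = LinearMap.id

section

variable {K A V W : Type u} [Field K] [CommRing A] [Algebra K A]
  [AddCommGroup V] [Module K V] [AddCommGroup W] [Module K W]

/-- `Hom_G(V, W)`: the linear maps that commute with the coactions. -/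
def homG (ρ : V →ₗ[K] V ⊗[K] A) (τ : W →ₗ[K] W ⊗[K] A) : Submodule K (V →ₗ[K] W) where
  carrier := {f | τ ∘ₗ f = f.rTensor A ∘ₗ ρ}
  zero_mem' := by simp
  add_mem' {f g} hf hg := by
    simp only [Set.mem_ofPred_eq] at hf hg ⊢
    rw [LinearMap.comp_add, hf, hg, LinearMap.rTensor_add, LinearMap.add_comp]
  smul_mem' c f hf := by
    simp only [Set.mem_ofPred_eq] at hf ⊢
    rw [LinearMap.comp_smul, hf, LinearMap.rTensor_smul, LinearMap.smul_comp]

/-- The multilinear map `(V ⊗ A)^r → V^{⊗ r} ⊗ A` that takes `(v₁ ⊗ a₁, …, v_r ⊗ a_r)` to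
`(v₁ ⊗ ⋯ ⊗ v_r) ⊗ a₁ ⋯ a_r` (see `mergeTensors_tmul`).  It is the product in the algebra
`T(V) ⊗ A`, followed by the projection of the tensor algebra `T(V)` to its component of
degree `r`. -/
def mergeTensors (K A V : Type u) [Field K] [CommRing A] [Algebra K A]
    [AddCommGroup V] [Module K V] (r : ℕ) :
    MultilinearMap K (fun _ : Fin r => V ⊗[K] A) ((⨂[K]^r V) ⊗[K] A) :=
  (((DirectSum.component K ℕ (fun n => ⨂[K]^n V) r) ∘ₗ
    (TensorAlgebra.toDirectSum (R := K) (M := V)).toLinearMap).rTensor A).compMultilinearMap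
    ((MultilinearMap.mkPiAlgebraFin K r (TensorAlgebra K V ⊗[K] A)).compLinearMap
      fun _ => (TensorAlgebra.ι K).rTensor A)

theorem mergeTensors_tmul (r : ℕ) (v : Fin r → V) (a : Fin r → A) :
    mergeTensors K A V r (fun i => v i ⊗ₜ[K] a i) =
      PiTensorProduct.tprod K v ⊗ₜ[K] ∏ i, a i := by
  have h : ∀ (n : ℕ) (w : Fin n → TensorAlgebra K V) (b : Fin n → A),
      (List.ofFn fun i => w i ⊗ₜ[K] b i).prod = (List.ofFn w).prod ⊗ₜ[K] ∏ i, b i := by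
    intro n
    induction n with
    | zero => intro w b; simp [Algebra.TensorProduct.one_def]
    | succ n ih =>
      intro w b
      rw [List.ofFn_succ, List.ofFn_succ, List.prod_cons, List.prod_cons, ih,
        Fin.prod_univ_succ, Algebra.TensorProduct.tmul_mul_tmul]
  have h2 : (List.ofFn fun i => TensorAlgebra.ι K (v i)).prod = TensorAlgebra.tprod K V r v := by
    rw [TensorAlgebra.tprod_apply]
  simp only [mergeTensors, LinearMap.compMultilinearMap_apply, MultilinearMap.compLinearMap_apply,
    LinearMap.rTensor_tmul, MultilinearMap.mkPiAlgebraFin_apply, h, h2, LinearMap.comp_apply,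
    AlgHom.toLinearMap_apply, TensorAlgebra.toDirectSum_tensorPower_tprod]
  congr 1
  exact DirectSum.of_eq_same (β := fun n => ⨂[K]^n V) r (PiTensorProduct.tprod K v)

theorem mergeTensors_perm (r : ℕ) (σ : Equiv.Perm (Fin r)) (x : Fin r → V ⊗[K] A) :
    (PiTensorProduct.reindex K (fun _ : Fin r => V) σ).toLinearMap.rTensor A
      (mergeTensors K A V r x) = mergeTensors K A V r fun i => x (σ.symm i) := by
  let L := ((PiTensorProduct.reindex K (fun _ : Fin r => V) σ).toLinearMap.rTensor
    A).compMultilinearMap (mergeTensors K A V r)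
  let R := (mergeTensors K A V r).domDomCongr σ.symm
  suffices L = R from DFunLike.congr_fun this x
  refine MultilinearMap.ext_of_span_eq_top (γ := fun _ => V × A)
    (g := fun _ p => p.1 ⊗ₜ[K] p.2) ?_ ?_
  · intro i
    rw [← TensorProduct.span_tmul_eq_top]
    congr 1
    ext t
    simp
  · intro j
    have h1 : L (fun i => (j i).1 ⊗ₜ[K] (j i).2) =
        (PiTensorProduct.tprod K fun i => (j (σ.symm i)).1) ⊗ₜ[K] ∏ i, (j i).2 := by
      simp only [L, LinearMap.compMultilinearMap_apply,
        mergeTensors_tmul r (fun i => (j i).1) fun i => (j i).2, LinearMap.rTensor_tmul,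
        LinearEquiv.coe_coe, PiTensorProduct.reindex_tprod]
    have h2 : R (fun i => (j i).1 ⊗ₜ[K] (j i).2) =
        (PiTensorProduct.tprod K fun i => (j (σ.symm i)).1) ⊗ₜ[K] ∏ i, (j (σ.symm i)).2 :=
      mergeTensors_tmul r (fun i => (j (σ.symm i)).1) fun i => (j (σ.symm i)).2
    rw [h1, h2, Equiv.prod_comp σ.symm fun i => (j i).2]

/-- The diagonal action of `G` on the tensor power `T^r(V)`. -/
def tensorCoact (r : ℕ) (ρ : V →ₗ[K] V ⊗[K] A) : (⨂[K]^r V) →ₗ[K] (⨂[K]^r V) ⊗[K] A :=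
  PiTensorProduct.lift ((mergeTensors K A V r).compLinearMap fun _ => ρ)

/-- The symmetric group permutes the factors of `T^r(V)`. -/
def permTensor (K V : Type u) [Field K] [AddCommGroup V] [Module K V] (r : ℕ) :
    Representation K (Equiv.Perm (Fin r)) (⨂[K]^r V) where
  toFun σ := (PiTensorProduct.reindex K (fun _ : Fin r => V) σ).toLinearMap
  map_one' := by
    ext v
    simp only [LinearMap.compMultilinearMap_apply, LinearEquiv.coe_coe,
      PiTensorProduct.reindex_tprod]
    rfl
  map_mul' σ τ := by
    ext v
    simp only [LinearMap.compMultilinearMap_apply, LinearEquiv.coe_coe, Module.End.mul_apply,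
      PiTensorProduct.reindex_tprod]
    rfl

theorem tensorCoact_perm (r : ℕ) (ρ : V →ₗ[K] V ⊗[K] A) (σ : Equiv.Perm (Fin r)) :
    tensorCoact r ρ ∘ₗ permTensor K V r σ =
      (permTensor K V r σ).rTensor A ∘ₗ tensorCoact r ρ := by
  have hσ : ∀ v : Fin r → V, permTensor K V r σ (PiTensorProduct.tprod K v) =
      PiTensorProduct.tprod K fun i => v (σ.symm i) :=
    fun v => PiTensorProduct.reindex_tprod σ v
  ext v
  simp only [LinearMap.compMultilinearMap_apply, LinearMap.comp_apply, hσ]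
  simp only [tensorCoact, PiTensorProduct.lift.tprod, MultilinearMap.compLinearMap_apply]
  exact (mergeTensors_perm r σ fun i => ρ (v i)).symm

/-- The action of the symmetric group on `Hom_G(T^r(V), W)`, with `σ φ = φ ∘ σ⁻¹`. -/
def permHom (r : ℕ) (ρ : V →ₗ[K] V ⊗[K] A) (τ : W →ₗ[K] W ⊗[K] A) :
    Representation K (Equiv.Perm (Fin r)) (homG (tensorCoact r ρ) τ) where
  toFun σ := ((permTensor K V r σ⁻¹).lcomp K W).restrict (p := homG (tensorCoact r ρ) τ)
    (q := homG (tensorCoact r ρ) τ) (by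
      intro φ hφ
      change τ ∘ₗ (φ ∘ₗ permTensor K V r σ⁻¹) =
        (φ ∘ₗ permTensor K V r σ⁻¹).rTensor A ∘ₗ tensorCoact r ρ
      have h : τ ∘ₗ φ = φ.rTensor A ∘ₗ tensorCoact r ρ := hφ
      rw [← LinearMap.comp_assoc, h, LinearMap.comp_assoc, tensorCoact_perm,
        LinearMap.rTensor_comp, LinearMap.comp_assoc])
  map_one' := by
    ext φ : 2
    change φ.1 ∘ₗ permTensor K V r 1⁻¹ = φ.1
    rw [inv_one, map_one]
    rfl
  map_mul' σ σ' := by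
    ext φ : 2
    change φ.1 ∘ₗ permTensor K V r (σ * σ')⁻¹ =
      (φ.1 ∘ₗ permTensor K V r σ'⁻¹) ∘ₗ permTensor K V r σ⁻¹
    rw [mul_inv_rev, map_mul]
    rfl

/-- The Frobenius character `(1/r!) ∑ σ, Tr (ρ σ) p_{λ(σ)}` of a representation of the symmetric
group on `r` letters, `λ(σ)` being the cycle type of `σ` (with its fixed points). -/
def frobChar {E : Type u} [AddCommGroup E] [Module K E] {r : ℕ}
    (ρ : Representation K (Equiv.Perm (Fin r)) E) : SymFun K :=
  ((r.factorial : ℕ) : K)⁻¹ •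
    ∑ σ : Equiv.Perm (Fin r), LinearMap.trace K E (ρ σ) • pProd σ.partition.parts

/-- The graded Frobenius character `ch Hom_G(T^•(V), W) = ∑ r, ch Hom_G(T^r(V), W)`. -/
def homChar (ρ : V →ₗ[K] V ⊗[K] A) (τ : W →ₗ[K] W ⊗[K] A) : SymFun K :=
  gradedSum fun r => frobChar (permHom r ρ τ)

/-- The representation of `G` on `P(V)`.  An action of `G` on `V` amounts to an element of
`End(V) ⊗ A` (the action of the universal point of `G`); the polynomial map
`End(V) → End(P(V))` has values at points over the algebra `A` and takes this element to the one
that gives the action on `P(V)`.  (As `K` is infinite, the polynomial law is unique.) -/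
def functorCoact [Module.Finite K V] {P : FGModuleCat.{u} K ⥤ FGModuleCat.{u} K}
    (hP : IsPolynomialFunctor P) (ρ : V →ₗ[K] V ⊗[K] A) :
    P.obj (FGModuleCat.of K V) →ₗ[K] P.obj (FGModuleCat.of K V) ⊗[K] A :=
  let PV := P.obj (FGModuleCat.of K V)
  let g : A ⊗[K] (V →ₗ[K] V) :=
    TensorProduct.comm K (V →ₗ[K] V) A ((rTensorHomEquivHomRTensor K V V A).symm ρ)
  let Pg : A ⊗[K] (PV →ₗ[K] PV) :=
    (hP (FGModuleCat.of K V) (FGModuleCat.of K V)).choose.toFun' A g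
  rTensorHomEquivHomRTensor K PV PV A (TensorProduct.comm K A (PV →ₗ[K] PV) Pg)

end

end

end TensorInvariants

namespace TensorInvariants

noncomputable section

/-! ### Exponent vectors and partitions -/

/-! Let Q be a polynomial functor with a natural endomorphism s. Polarizing the degree d component
of Q and evaluating at K^d gives, for x in Q(K^d) and ξ in its dual, maps `inMap` : T^d(V) → Q(V)
and `outMap` : Q(V) → T^d(V) that commute with all endomorphisms of V. Let x and ξ run through a
basis of Q(K^d) and its dual basis. Then ∑ in ∘ out is the polarization of Q at (id, …, id), that
is, d! times the degree d part of the identity of Q(V) (`sum_inMap_comp_outMap`), while ∑ out ∘ s ∘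
in is a combination ∑ w_d(π) π of permutations of the tensor factors, w_d(π) being `permCoeff`
(`sum_outMap_comp_inMap`).

Cyclicity of the trace now yields two formulas with the same w_d. On Q(V), composed with Q(g) for
diagonal g (`sum_permCoeff_mul_trace`), it shows that F = ∑ (1/d!) ∑ w_d(π) p_{λ(π)} is the
character of (Q, s). On the spaces Hom_G(-, W) (`sum_permCoeff_mul_trace_precomp`), it shows that
precomposition with s on Hom_G(Q(V), W) has trace ⟨F, ch Hom_G(T^•(V), W)⟩. Complete reducibility
plays no role. It suffices that the in and out maps are G-equivariant, and they are because an
identity between polynomial maps over the infinite field K persists at the A-point of End(V) that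
describes the coaction (`mem_homG_of_isValueAt`).

Take Q = T^r ∘ P and let s permute the factors with cycle type λ. The trace of a permutation times
h^{⊗r} is the product of Tr(h^k) over the cycle lengths k (`trace_permTensor_comp_tensorMap`), and a
symmetric function is determined by its values (`eq_of_hasValue`), so F = p_λ[ch P]
(`prod_adams_functorChar`). The coefficient of p_λ[X] in H[X · (ch P)[Y]] is z_λ⁻¹ p_λ[ch P][Y]
(`coeff_pleth`), and the theorem follows by comparing coefficients. Only finitely many d contribute
because T^r ∘ P has bounded degree on End(V). -/

theorem expOf_apply (s : Multiset ℕ) (k : ℕ+) : expOf s k = s.count (k : ℕ) := by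
  simp [expOf, Finsupp.comapDomain_apply]

theorem expOf_cons (k : ℕ+) (s : Multiset ℕ) :
    expOf ((k : ℕ) ::ₘ s) = Finsupp.single k 1 + expOf s := by
  ext j
  rw [Finsupp.add_apply, expOf_apply, expOf_apply, Multiset.count_cons, Finsupp.single_apply,
    add_comm]
  simp only [PNat.coe_inj, eq_comm]

theorem expOf_zero : expOf 0 = 0 := by
  ext j
  simp [expOf_apply]

theorem expOf_prod {M : Type*} [CommMonoid M] (f : ℕ → M) (s : Multiset ℕ)
    (hs : ∀ k ∈ s, 0 < k) :
    ((expOf s).prod fun k e => f k ^ e) = (s.map f).prod := by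
  induction s using Multiset.induction_on with
  | empty => simp [expOf_zero]
  | cons a s ih =>
    have ha : 0 < a := hs a (Multiset.mem_cons_self a s)
    lift a to ℕ+ using ha
    rw [expOf_cons, Finsupp.prod_add_index' (by simp) (by simp [pow_add]),
      ih fun k hk => hs k (Multiset.mem_cons_of_mem hk), Finsupp.prod_single_index (by simp)]
    simp

theorem size_expOf (s : Multiset ℕ) (hs : ∀ k ∈ s, 0 < k) : size (expOf s) = s.sum := by
  induction s using Multiset.induction_on with
  | empty => simp [expOf_zero, size]
  | cons a s ih =>
    have ha : 0 < a := hs a (Multiset.mem_cons_self a s)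
    lift a to ℕ+ using ha
    have ih' := ih fun k hk => hs k (Multiset.mem_cons_of_mem hk)
    rw [size] at ih' ⊢
    rw [expOf_cons, Finsupp.sum_add_index' (by simp) (by simp [mul_add]), ih',
      Finsupp.sum_single_index (by simp)]
    simp

theorem size_expOf_partition {d : ℕ} (l : d.Partition) : size (expOf l.parts) = d := by
  rw [size_expOf _ fun k hk => l.parts_pos hk, l.parts_sum]

theorem expOf_injective {d d' : ℕ} {l : d.Partition} {l' : d'.Partition}
    (h : expOf l.parts = expOf l'.parts) : l.parts = l'.parts := by
  ext k
  -- `expOf` does not see the multiplicity of 0, but partitions have no zero parts.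
  rcases Nat.eq_zero_or_pos k with rfl | hk
  · rw [Multiset.count_eq_zero_of_notMem, Multiset.count_eq_zero_of_notMem]
    · exact fun h => (l'.parts_pos h).ne rfl
    · exact fun h => (l.parts_pos h).ne rfl
  · lift k to ℕ+ using hk
    rw [← expOf_apply, h, expOf_apply]

/-- The parts of the partition with a given exponent vector. -/
def partsOf (m : ℕ+ →₀ ℕ) : Multiset ℕ := (Finsupp.toMultiset m).map fun k : ℕ+ => (k : ℕ)

theorem expOf_partsOf (m : ℕ+ →₀ ℕ) : expOf (partsOf m) = m := by
  ext k
  rw [expOf_apply, partsOf, Multiset.count_map_eq_count' _ _ PNat.coe_injective,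
    Finsupp.count_toMultiset]

theorem partsOf_pos (m : ℕ+ →₀ ℕ) {i : ℕ} (hi : i ∈ partsOf m) : 0 < i := by
  obtain ⟨k, -, rfl⟩ := Multiset.mem_map.1 hi
  exact k.pos

theorem partsOf_sum (m : ℕ+ →₀ ℕ) : (partsOf m).sum = size m := by
  rw [← size_expOf _ fun _ hk => partsOf_pos m hk, expOf_partsOf]

/-- Partitions of `d` and exponent vectors of size `d`. -/
def partitionEquiv (d : ℕ) : d.Partition ≃ {m : ℕ+ →₀ ℕ // size m = d} where
  toFun l := ⟨expOf l.parts, size_expOf_partition l⟩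
  invFun m := ⟨partsOf m.1, partsOf_pos m.1, (partsOf_sum m.1).trans m.2⟩
  left_inv l := Nat.Partition.ext
    (expOf_injective (l := ⟨_, partsOf_pos _, rfl⟩) (expOf_partsOf (expOf l.parts)))
  right_inv m := Subtype.ext (expOf_partsOf m.1)

/-! ### Evaluation of symmetric functions -/

section

variable {K : Type u} [Field K]

/-- The value of the power sum product `p^m` at `(a₁, …, a_n, 0, 0, …)`. -/
def evalExp {n : ℕ} (a : Fin n → K) (m : ℕ+ →₀ ℕ) : K :=
  m.prod fun k e => (∑ i, a i ^ (k : ℕ)) ^ e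

theorem evalPart_eq (f : SymFun K) {n : ℕ} (a : Fin n → K) (d : ℕ) :
    evalPart f a d =
      ∑ l : d.Partition, MvPowerSeries.coeff (expOf l.parts) f * evalExp a (expOf l.parts) := by
  refine Finset.sum_congr rfl fun _ _ => ?_
  rw [evalExp, expOf_prod (fun k => ∑ i, a i ^ k) _ fun _ hk => Nat.Partition.parts_pos _ hk]

/-- The images of the power sums under `evalSeries`. -/
def evalVar {n : ℕ} (a : Fin n → K) (k : ℕ+) : MvPowerSeries Unit K :=
  PowerSeries.monomial (k : ℕ) (∑ i, a i ^ (k : ℕ))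

/-- The images of the p_k are monomials of distinct positive degrees, so each coefficient is nonzero
for at most one k. -/
theorem hasSubst_evalVar {n : ℕ} (a : Fin n → K) : MvPowerSeries.HasSubst (evalVar a) where
  const_coeff k := by
    have : MvPowerSeries.constantCoeff (evalVar a k) = 0 := by
      change PowerSeries.constantCoeff (PowerSeries.monomial (k : ℕ) (∑ i, a i ^ (k : ℕ))) = 0
      rw [← PowerSeries.coeff_zero_eq_constantCoeff_apply, PowerSeries.coeff_monomial,
        if_neg k.pos.ne]
    rw [this]
    exact IsNilpotent.zero
  coeff_zero d := by
    refine Set.Subsingleton.finite fun k hk j hj => ?_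
    have h : ∀ k : ℕ+, MvPowerSeries.coeff d (evalVar a k) ≠ 0 → d () = k := by
      intro k hk
      by_contra h
      refine hk ?_
      have hd : d = Finsupp.single () (d ()) := by ext; simp
      rw [hd]
      change PowerSeries.coeff (d ()) (PowerSeries.monomial (k : ℕ) (∑ i, a i ^ (k : ℕ))) = 0
      rw [PowerSeries.coeff_monomial, if_neg h]
    exact PNat.coe_injective ((h k hk).symm.trans (h j hj))

/-- The algebra homomorphism that takes a symmetric function with components `f_d` to
`∑ d, f_d(a₁, …, a_n, 0, 0, …) t^d`. -/
def evalSeries {n : ℕ} (a : Fin n → K) : SymFun K →ₐ[K] PowerSeries K :=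
  MvPowerSeries.substAlgHom (hasSubst_evalVar a)

theorem prod_evalVar {n : ℕ} (a : Fin n → K) (m : ℕ+ →₀ ℕ) :
    (m.prod fun k e => evalVar a k ^ e) = PowerSeries.monomial (size m) (evalExp a m) := by
  induction m using Finsupp.induction_linear with
  | zero => simp [size, evalExp]
  | add f g hf hg =>
    rw [Finsupp.prod_add_index' (by simp) (by simp [pow_add]), hf, hg, size, size, size,
      evalExp, evalExp, evalExp, Finsupp.prod_add_index' (by simp) (by simp [pow_add]),
      Finsupp.sum_add_index' (by simp) (by simp [mul_add]), PowerSeries.monomial_mul_monomial]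
  | single k e =>
    rw [size, evalExp, Finsupp.prod_single_index (by simp), Finsupp.prod_single_index (by simp),
      Finsupp.sum_single_index (by simp), mul_comm]
    exact PowerSeries.monomial_pow ..

theorem coeff_evalSeries {n : ℕ} (a : Fin n → K) (f : SymFun K) (d : ℕ) :
    PowerSeries.coeff d (evalSeries a f) = evalPart f a d := by
  rw [evalPart_eq, evalSeries, MvPowerSeries.substAlgHom_apply, PowerSeries.coeff,
    MvPowerSeries.coeff_subst (hasSubst_evalVar a)]
  have h : ∀ m : ℕ+ →₀ ℕ, MvPowerSeries.coeff m f • MvPowerSeries.coeff (Finsupp.single () d)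
      (m.prod fun k e => evalVar a k ^ e) =
      if size m = d then MvPowerSeries.coeff m f * evalExp a m else 0 := by
    intro m
    rw [prod_evalVar]
    change _ • PowerSeries.coeff d _ = _
    rw [PowerSeries.coeff_monomial, smul_eq_mul]
    simp only [eq_comm, mul_ite, mul_zero]
  simp_rw [h]
  simp_rw [← finsum_eq_if]
  rw [← finsum_subtype_eq_finsum_cond (f := fun m => MvPowerSeries.coeff m f * evalExp a m),
    ← finsum_comp_equiv (partitionEquiv d), finsum_eq_sum_of_fintype]
  rfl


theorem evalExp_smul {n : ℕ} (t : K) (a : Fin n → K) (m : ℕ+ →₀ ℕ) :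
    evalExp (t • a) m = t ^ size m * evalExp a m := by
  rw [evalExp, evalExp, size, Finsupp.prod, Finsupp.prod, Finsupp.sum,
    ← Finset.prod_pow_eq_pow_sum, ← Finset.prod_mul_distrib]
  refine Finset.prod_congr rfl fun k _ => ?_
  simp only [Pi.smul_apply, smul_eq_mul, mul_pow, ← Finset.mul_sum, pow_mul]

theorem evalPart_smul (f : SymFun K) {n : ℕ} (t : K) (a : Fin n → K) (d : ℕ) :
    evalPart f (t • a) d = t ^ d * evalPart f a d := by
  rw [evalPart_eq, evalPart_eq, Finset.mul_sum]
  refine Finset.sum_congr rfl fun l _ => ?_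
  rw [evalExp_smul, size_expOf_partition]
  ring

/-- The components of `f` of almost all degrees vanish at `(a₁, …, a_n, 0, 0, …)`, and the values of
the others add up to `c`. -/
def HasValue (f : SymFun K) {n : ℕ} (a : Fin n → K) (c : K) : Prop :=
  ∃ p : Polynomial K, evalSeries a f = (p : PowerSeries K) ∧ p.eval 1 = c

/-- With the degree recorded by t, finiteness says that the image in K[[t]] is a polynomial, and the
value is taken at t = 1. Sums and products of values then come from the ring homomorphism
`evalSeries`. -/
theorem hasValue_iff {f : SymFun K} {n : ℕ} {a : Fin n → K} {c : K} :
    HasValue f a c ↔ (Function.support (evalPart f a)).Finite ∧ ∑ᶠ d, evalPart f a d = c := by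
  have hsum : ∀ p : Polynomial K, ∑ᶠ d, p.coeff d = p.eval 1 := by
    intro p
    rw [Polynomial.eval_eq_sum, Polynomial.sum, finsum_eq_sum_of_support_subset (s := p.support)]
    · simp
    · intro d hd
      simpa using hd
  constructor
  · rintro ⟨p, hp, rfl⟩
    have h : ∀ d, evalPart f a d = p.coeff d := fun d => by
      rw [← coeff_evalSeries, hp, Polynomial.coeff_coe]
    refine ⟨p.support.finite_toSet.subset fun d hd => ?_, ?_⟩
    · simpa [h] using hd
    · simp_rw [h, hsum]
  · rintro ⟨hfin, rfl⟩
    refine ⟨∑ d ∈ hfin.toFinset, Polynomial.monomial d (evalPart f a d), ?_, ?_⟩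
    · ext d
      rw [coeff_evalSeries, Polynomial.coeff_coe, Polynomial.finsetSum_coeff]
      simp only [Polynomial.coeff_monomial, Finset.sum_ite_eq', Set.Finite.mem_toFinset,
        Function.mem_support]
      split_ifs with h
      · rfl
      · simpa using h
    · rw [Polynomial.eval_finsetSum, finsum_eq_sum _ hfin]
      simp

theorem HasValue.mul {f g : SymFun K} {n : ℕ} {a : Fin n → K} {b c : K} (hf : HasValue f a b)
    (hg : HasValue g a c) : HasValue (f * g) a (b * c) := by
  obtain ⟨p, hp, rfl⟩ := hf
  obtain ⟨q, hq, rfl⟩ := hg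
  exact ⟨p * q, by rw [map_mul, hp, hq, Polynomial.coe_mul], Polynomial.eval_mul⟩

theorem HasValue.sub {f g : SymFun K} {n : ℕ} {a : Fin n → K} {b c : K} (hf : HasValue f a b)
    (hg : HasValue g a c) : HasValue (f - g) a (b - c) := by
  obtain ⟨p, hp, rfl⟩ := hf
  obtain ⟨q, hq, rfl⟩ := hg
  exact ⟨p - q, by rw [map_sub, hp, hq, Polynomial.coe_sub], Polynomial.eval_sub ..⟩

theorem hasValue_one {n : ℕ} (a : Fin n → K) : HasValue 1 a 1 :=
  ⟨1, by simp, by simp⟩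

theorem HasValue.pow {f : SymFun K} {n : ℕ} {a : Fin n → K} {c : K} (hf : HasValue f a c)
    (e : ℕ) : HasValue (f ^ e) a (c ^ e) := by
  obtain ⟨p, hp, rfl⟩ := hf
  exact ⟨p ^ e, by rw [map_pow, hp, Polynomial.coe_pow], Polynomial.eval_pow _⟩

theorem HasValue.prod {ι : Type*} (s : Finset ι) {f : ι → SymFun K} {n : ℕ} {a : Fin n → K}
    {c : ι → K} (hf : ∀ i ∈ s, HasValue (f i) a (c i)) :
    HasValue (∏ i ∈ s, f i) a (∏ i ∈ s, c i) := by
  classical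
  induction s using Finset.induction_on with
  | empty => simpa using hasValue_one a
  | insert i s hi ih =>
    rw [Finset.prod_insert hi, Finset.prod_insert hi]
    exact (hf i (Finset.mem_insert_self i s)).mul
      (ih fun j hj => hf j (Finset.mem_insert_of_mem hj))

/-- The plethysm `p_k[f]`, in one alphabet. -/
def adams (k : ℕ+) : SymFun K →ₐ[K] SymFun K := MvPowerSeries.rename (mulEmb k)

/-- Both sides substitute (∑ a_i^{kj}) t^{kj} for p_j. -/
theorem evalSeries_adams (k : ℕ+) (f : SymFun K) {n : ℕ} (a : Fin n → K) :
    evalSeries a (adams k f) =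
      PowerSeries.expand (k : ℕ) k.ne_zero (evalSeries (fun i => a i ^ (k : ℕ)) f) := by
  have h1 : evalSeries a (adams k f) =
      MvPowerSeries.subst (fun j => evalVar a (k * j)) f := by
    rw [evalSeries, MvPowerSeries.substAlgHom_apply, adams, MvPowerSeries.rename_eq_subst,
      MvPowerSeries.subst_comp_subst_apply (MvPowerSeries.HasSubst.X_comp _) (hasSubst_evalVar a)]
    congr 1
    funext j
    rw [Function.comp_apply, MvPowerSeries.subst_X (hasSubst_evalVar a)]
    rfl
  have h2 : PowerSeries.expand (k : ℕ) k.ne_zero (evalSeries (fun i => a i ^ (k : ℕ)) f) =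
      MvPowerSeries.subst
        (fun j => MvPowerSeries.expand (k : ℕ) k.ne_zero (evalVar (fun i => a i ^ (k : ℕ)) j))
        f := by
    rw [evalSeries, MvPowerSeries.substAlgHom_apply]
    exact MvPowerSeries.expand_subst _ _ (hasSubst_evalVar _)
  rw [h1, h2]
  congr 1
  funext j
  refine Eq.trans ?_ (PowerSeries.expand_monomial (k : ℕ) k.ne_zero (j : ℕ) _).symm
  rw [evalVar, PNat.mul_coe]
  simp only [pow_mul]

theorem HasValue.adams {f : SymFun K} {n : ℕ} {a : Fin n → K} {c : K} {k : ℕ+}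
    (hf : HasValue f (fun i => a i ^ (k : ℕ)) c) : HasValue (adams k f) a c := by
  obtain ⟨p, hp, rfl⟩ := hf
  refine ⟨Polynomial.expand K k p, ?_, by rw [Polynomial.expand_eval, one_pow]⟩
  rw [evalSeries_adams, hp]
  ext d
  rw [PowerSeries.coeff_expand, Polynomial.coeff_coe, Polynomial.coeff_coe,
    Polynomial.coeff_expand k.pos]

/-- The power sums are algebraically independent as functions on all `K^n`. -/
theorem eq_zero_of_evalPart_eq_zero [CharZero K] {f : SymFun K}
    (hf : ∀ (n : ℕ) (a : Fin n → K), (∀ i, a i ≠ 0) → ∀ d, evalPart f a d = 0) : f = 0 := by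
  ext m
  rw [map_zero]
  obtain ⟨d, hd⟩ : ∃ d, size m = d := ⟨_, rfl⟩
  let b : Fin d → K := fun j => ((j : ℕ) + 1 : ℕ)
  have hb : ∀ j, b j ≠ 0 := fun j => Nat.cast_ne_zero.2 (Nat.succ_ne_zero _)
  have hbinj : Function.Injective b := fun i j h => by
    simpa [b, Fin.ext_iff] using h
  let c : d.Partition → K := fun l => MvPowerSeries.coeff (expOf l.parts) f
  -- For natural numbers M_j this is the hypothesis at the point where each b_j is repeated M_j
  -- times. Both sides are polynomial in M, so it extends to all M.
  have step1 : ∀ M : Fin d → K,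
      ∑ l : d.Partition, c l * (l.parts.map fun k => ∑ j, M j * b j ^ k).prod = 0 := by
    let q : MvPolynomial (Fin d) K := ∑ l : d.Partition, MvPolynomial.C (c l) *
      (l.parts.map fun k => ∑ j, MvPolynomial.X j * MvPolynomial.C (b j ^ k)).prod
    have hq : ∀ M, MvPolynomial.eval M q =
        ∑ l : d.Partition, c l * (l.parts.map fun k => ∑ j, M j * b j ^ k).prod := by
      intro M
      simp only [q, map_sum, map_mul, map_multiset_prod, Multiset.map_map, Function.comp_def,
        MvPolynomial.eval_C, MvPolynomial.eval_X]
    have hq0 : q = 0 := by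
      refine MvPolynomial.funext_set (fun _ => Set.range ((↑) : ℕ → K))
        (fun _ => Set.infinite_range_of_injective Nat.cast_injective) fun M hM => ?_
      choose N hN using fun j => hM j (Set.mem_univ j)
      let e := Fintype.equivFin (Σ j : Fin d, Fin (N j))
      have h := hf _ (fun i => b (e.symm i).1) (fun i => hb _) d
      rw [hq, map_zero, ← h, evalPart]
      refine Finset.sum_congr rfl fun l _ => ?_
      have : ∀ k : ℕ, ∑ i, b (e.symm i).1 ^ k = ∑ j, M j * b j ^ k := by
        intro k
        rw [Equiv.sum_comp e.symm fun x => b x.1 ^ k, Fintype.sum_sigma]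
        simp [hN]
      simp only [this, c]
    intro M
    rw [← hq, hq0, map_zero]
  -- Weighted power sums ∑ M_j b_j^k with 1 ≤ k ≤ d take arbitrary prescribed values y_k, by
  -- invertibility of a Vandermonde matrix. So the component of degree d vanishes as a polynomial in
  -- independent variables p_k.
  have step2 : (∑ l : d.Partition, MvPolynomial.monomial (expOf l.parts) (c l)) = 0 := by
    refine MvPolynomial.funext fun y => ?_
    obtain ⟨M, hM⟩ : ∃ M : Fin d → K, ∀ i : Fin d,
        ∑ j, M j * b j ^ ((i : ℕ) + 1) = y (Nat.succPNat i) := by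
      have hdet : IsUnit (Matrix.vandermonde b).det :=
        (Matrix.det_vandermonde_ne_zero_iff.2 hbinj).isUnit
      let w : Fin d → K := Matrix.vecMul (fun i : Fin d => y (Nat.succPNat i)) (Matrix.vandermonde b)⁻¹
      have hw : Matrix.vecMul w (Matrix.vandermonde b) =
          fun i : Fin d => y (Nat.succPNat i) := by
        rw [Matrix.vecMul_vecMul, Matrix.nonsing_inv_mul _ hdet, Matrix.vecMul_one]
      -- The Vandermonde exponents start at 0 and those of the power sums at 1, hence the factor
      -- b_j⁻¹.
      refine ⟨fun j => w j * (b j)⁻¹, fun i => ?_⟩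
      rw [← congr_fun hw i, Matrix.vecMul, dotProduct]
      refine Finset.sum_congr rfl fun j _ => ?_
      rw [Matrix.vandermonde_apply, pow_succ']
      field_simp [hb j]
    rw [map_zero, map_sum, ← step1 M]
    refine Finset.sum_congr rfl fun l _ => ?_
    rw [MvPolynomial.eval_monomial]
    congr 1
    let Y : ℕ → K := fun k => if h : 0 < k then y ⟨k, h⟩ else 0
    have hY : ∀ k : ℕ+, Y k = y k := fun k => dif_pos k.pos
    simp_rw [← hY]
    rw [expOf_prod Y _ fun k hk => l.parts_pos hk]
    refine congrArg Multiset.prod (Multiset.map_congr rfl fun k hk => ?_)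
    have hk0 : 0 < k := l.parts_pos hk
    have hkd : k ≤ d := (Multiset.le_sum_of_mem hk).trans l.parts_sum.le
    obtain ⟨i, rfl⟩ : ∃ i, k = i + 1 := ⟨k - 1, by omega⟩
    rw [hM ⟨i, hkd⟩]
    exact hY (Nat.succPNat i)
  let l : d.Partition := (partitionEquiv d).symm ⟨m, hd⟩
  have hl : expOf l.parts = m := expOf_partsOf m
  have h := congrArg (MvPolynomial.coeff (expOf l.parts)) step2
  rw [MvPolynomial.coeff_sum, MvPolynomial.coeff_zero, Finset.sum_eq_single l] at h
  · rw [MvPolynomial.coeff_monomial, if_pos rfl] at h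
    rw [← hl]
    exact h
  · intro l' _ hne
    rw [MvPolynomial.coeff_monomial, if_neg]
    exact fun h => hne (Nat.Partition.ext (expOf_injective h))
  · exact fun h => absurd (Finset.mem_univ l) h

/-- A symmetric function is determined by its values. -/
theorem eq_of_hasValue [CharZero K] {f g : SymFun K} (χ : ∀ n : ℕ, (Fin n → K) → K)
    (hf : ∀ (n : ℕ) (a : Fin n → K), (∀ i, a i ≠ 0) → HasValue f a (χ n a))
    (hg : ∀ (n : ℕ) (a : Fin n → K), (∀ i, a i ≠ 0) → HasValue g a (χ n a)) : f = g := by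
  refine sub_eq_zero.1 (eq_zero_of_evalPart_eq_zero fun n a ha d => ?_)
  -- The hypotheses control only the sum over all degrees. Scaling a by t turns this sum into p(t),
  -- where p has the values of the components as coefficients; p then has infinitely many roots.
  have h : ∀ t : K, t ≠ 0 → HasValue (f - g) (t • a) 0 := by
    intro t ht
    have hta : ∀ i, (t • a) i ≠ 0 := fun i => mul_ne_zero ht (ha i)
    simpa using (hf n _ hta).sub (hg n _ hta)
  obtain ⟨p, hp, -⟩ := h 1 one_ne_zero
  rw [one_smul] at hp
  suffices p = 0 by rw [← coeff_evalSeries, hp, this, Polynomial.coe_zero, map_zero]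
  refine Polynomial.eq_zero_of_infinite_isRoot p
    ((Set.finite_singleton (0 : K)).infinite_compl.mono fun t ht => ?_)
  obtain ⟨q, hq, hq0⟩ := h t ht
  have hqp : q = p.comp (Polynomial.C t * Polynomial.X) := by
    ext d
    rw [Polynomial.comp_C_mul_X_coeff, ← Polynomial.coeff_coe, ← hq, coeff_evalSeries,
      evalPart_smul, ← coeff_evalSeries, hp, Polynomial.coeff_coe, mul_comm]
  rw [hqp, Polynomial.eval_comp] at hq0
  simpa using hq0

end

/-! ### The plethysm `H[X · F[Y]]` -/

section

variable {K : Type u} [Field K]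

theorem pPleth_alphX_mul_inY (k : ℕ+) (F : SymFun K) :
    pPleth k (alphX * inY F) = MvPowerSeries.X (Sum.inl k) * inY (adams k F) := by
  rw [map_mul, alphX, pPleth, MvPowerSeries.rename_X, inY, adams, MvPowerSeries.rename_rename,
    MvPowerSeries.rename_rename]
  congr 2
  simp [mulEmb]

theorem hasSubst_pPleth (F : SymFun K) :
    MvPowerSeries.HasSubst fun k => pPleth k (alphX * inY F) := by
  simp_rw [pPleth_alphX_mul_inY]
  exact (MvPowerSeries.HasSubst.X_comp (Function.Embedding.inl : ℕ+ ↪ ℕ+ ⊕ ℕ+)).mul_right _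

theorem coeff_sumElim_inY (m l : ℕ+ →₀ ℕ) (F : SymFun K) :
    MvPowerSeries.coeff (m.sumElim l) (inY F) = if m = 0 then MvPowerSeries.coeff l F else 0 := by
  split_ifs with h
  · subst h
    have : (0 : ℕ+ →₀ ℕ).sumElim l = l.embDomain Function.Embedding.inr := by
      ext x
      rcases x with x | x
      · rw [Finsupp.embDomain_of_notMem_range _ _ _ (by simp)]
        simp
      · exact (Finsupp.embDomain_apply_self Function.Embedding.inr l x).symm
    rw [this, inY, MvPowerSeries.coeff_embDomain_rename]
  · obtain ⟨k, hk⟩ := Finsupp.ne_iff.1 h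
    refine MvPowerSeries.coeff_rename_eq_zero _ _ ?_
    rintro ⟨x, hx⟩
    have h2 := DFunLike.congr_fun hx (Sum.inl k)
    rw [Finsupp.mapDomain_of_notMem_range _ _ (by simp)] at h2
    exact hk h2.symm

theorem prod_pPleth (F : SymFun K) (m : ℕ+ →₀ ℕ) :
    (m.prod fun k e => pPleth k (alphX * inY F) ^ e) =
      MvPowerSeries.monomial (m.sumElim 0) 1 * inY (m.prod fun k e => adams k F ^ e) := by
  simp_rw [pPleth_alphX_mul_inY, mul_pow]
  rw [Finsupp.prod_mul, Finsupp.prod, Finsupp.prod, Finsupp.prod, map_prod]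
  simp_rw [map_pow]
  congr 1
  have : m.sumElim 0 = m.mapDomain (Sum.inl : ℕ+ → ℕ+ ⊕ ℕ+) := by
    ext x
    rcases x with x | x
    · exact (Finsupp.mapDomain_apply Sum.inl_injective m x).symm
    · rw [Finsupp.mapDomain_of_notMem_range _ _ (by simp)]
      simp
  rw [this, MvPowerSeries.monomial_mapDomain_apply_one]
  rfl

/-- p_μ[X · F[Y]] = p_μ[X] · p_μ[F][Y], so the X-exponent m singles out the term μ = m of H, whose
coefficient is z_m⁻¹. -/
theorem coeff_pleth (F : SymFun K) (m l : ℕ+ →₀ ℕ) :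
    MvPowerSeries.coeff (m.sumElim l) (pleth bigH (alphX * inY F)) =
      ((zee m : ℕ) : K)⁻¹ * MvPowerSeries.coeff l (m.prod fun k e => adams k F ^ e) := by
  classical
  rw [pleth, MvPowerSeries.coeff_subst (hasSubst_pPleth F), finsum_eq_single _ m]
  · rw [prod_pPleth, MvPowerSeries.coeff_monomial_mul, if_pos]
    · have : m.sumElim l - m.sumElim 0 = (0 : ℕ+ →₀ ℕ).sumElim l := by
        ext x
        rcases x with x | x <;> simp
      rw [this, coeff_sumElim_inY, if_pos rfl, one_mul, smul_eq_mul]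
      rfl
    · intro x
      rcases x with x | x <;> simp
  · intro m' hm
    rw [prod_pPleth, MvPowerSeries.coeff_monomial_mul]
    split_ifs with h
    · have h2 : m.sumElim l - m'.sumElim 0 = (m - m').sumElim l := by
        ext x
        rcases x with x | x <;> simp
      rw [h2, coeff_sumElim_inY, if_neg, mul_zero, smul_zero]
      intro h3
      refine hm (le_antisymm (fun k => by simpa using h (Sum.inl k)) (tsub_eq_zero_iff_le.1 h3))
    · rw [smul_zero]

end

/-! ### Closed walks along the cycles of a permutation -/

section

variable {K : Type*} [CommRing K] {J : Type*} [Fintype J] [DecidableEq J]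

/-- The arbitrary weight f on the two endpoints lets the induction absorb the first edge; it is
later specialized to the edge that closes the walk. -/
theorem sum_walk (N : Matrix J J K) (n : ℕ) (f : J → J → K) :
    ∑ β : Fin (n + 1) → J, f (β 0) (β (Fin.last n)) * ∏ i : Fin n, N (β i.castSucc) (β i.succ) =
      ∑ x, ∑ y, f x y * (N ^ n) x y := by
  induction n generalizing f with
  | zero =>
    rw [← Equiv.sum_comp (Equiv.funUnique (Fin 1) J).symm]
    simp [Matrix.one_apply]
  | succ n ih =>
    rw [← Equiv.sum_comp (Fin.consEquiv fun _ => J), Fintype.sum_prod_type, Finset.sum_comm]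
    have h := ih fun z y => ∑ x, f x y * N x z
    have h1 : ∀ β : Fin (n + 1) → J, ∀ x : J,
        f (Fin.consEquiv (fun _ => J) (x, β) 0)
          (Fin.consEquiv (fun _ => J) (x, β) (Fin.last (n + 1))) *
          ∏ i : Fin (n + 1), N (Fin.consEquiv (fun _ => J) (x, β) i.castSucc)
            (Fin.consEquiv (fun _ => J) (x, β) i.succ) =
        f x (β (Fin.last n)) * N x (β 0) * ∏ i : Fin n, N (β i.castSucc) (β i.succ) := by
      intro β x
      rw [Fin.prod_univ_succ]
      simp only [Fin.consEquiv_apply, Fin.cons_zero, Fin.cons_succ, Fin.castSucc_zero,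
        ← Fin.succ_last, ← Fin.succ_castSucc, mul_assoc]
    simp_rw [h1, ← Finset.sum_mul]
    rw [h]
    simp_rw [Finset.sum_mul]
    rw [Finset.sum_comm]
    have : ∀ y : J, ∑ z, ∑ x, f x y * N x z * (N ^ n) z y = ∑ x, f x y * (N ^ (n + 1)) x y := by
      intro y
      rw [Finset.sum_comm]
      refine Finset.sum_congr rfl fun x _ => ?_
      rw [pow_succ', Matrix.mul_apply, Finset.mul_sum]
      simp only [mul_assoc]
    simp_rw [this]
    rw [Finset.sum_comm]

/-- Listing ι along the cycle as x₀, τ x₀, τ² x₀, … makes a labelling into a closed walk. -/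
theorem sum_walk_of_isCycleOn {ι : Type*} [Fintype ι] [DecidableEq ι] [Nonempty ι]
    (τ : Equiv.Perm ι) (hτ : τ.IsCycleOn Set.univ) (N : Matrix J J K) :
    ∑ β : ι → J, ∏ i, N (β i) (β (τ i)) = (N ^ Fintype.card ι).trace := by
  obtain ⟨x₀⟩ := ‹Nonempty ι›
  have hτ' : τ.IsCycleOn ((Finset.univ : Finset ι) : Set ι) := by simpa using hτ
  obtain ⟨n, hn⟩ : ∃ n, Fintype.card ι = n + 1 :=
    ⟨_, (Nat.succ_pred_eq_of_pos (Fintype.card_pos_iff.2 ⟨x₀⟩)).symm⟩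
  have hinj : Function.Injective fun i : Fin (n + 1) => (τ ^ (i : ℕ)) x₀ := by
    intro i j h
    have h2 := (hτ'.pow_apply_eq_pow_apply (Finset.mem_univ x₀)).1 h
    rw [Finset.card_univ, hn] at h2
    exact Fin.ext (Nat.ModEq.eq_of_lt_of_lt h2 i.2 j.2)
  let e : Fin (n + 1) ≃ ι := Equiv.ofBijective _
    ((Fintype.bijective_iff_injective_and_card _).2 ⟨hinj, by rw [Fintype.card_fin, hn]⟩)
  have he : ∀ i, e i = (τ ^ (i : ℕ)) x₀ := fun i => rfl
  rw [← Equiv.sum_comp (e.arrowCongr (Equiv.refl J)), hn]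
  have h : ∀ β : Fin (n + 1) → J,
      ∏ i, N (e.arrowCongr (Equiv.refl J) β i) (e.arrowCongr (Equiv.refl J) β (τ i)) =
      N (β (Fin.last n)) (β 0) * ∏ i : Fin n, N (β i.castSucc) (β i.succ) := by
    intro β
    have h1 : ∀ i : Fin n, e.symm (τ (e i.castSucc)) = i.succ := by
      intro i
      rw [Equiv.symm_apply_eq, he, he, Fin.val_succ, Fin.val_castSucc, pow_succ',
        Equiv.Perm.mul_apply]
    have h2 : e.symm (τ (e (Fin.last n))) = 0 := by
      rw [Equiv.symm_apply_eq, he, he, Fin.val_last, Fin.val_zero, ← Equiv.Perm.mul_apply,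
        ← pow_succ', ← hn, ← Finset.card_univ, hτ'.pow_card_apply (Finset.mem_univ x₀), pow_zero,
        Equiv.Perm.one_apply]
    rw [← Equiv.prod_comp e, Fin.prod_univ_castSucc, mul_comm]
    simp only [Equiv.arrowCongr_apply, Function.comp_apply, Equiv.symm_apply_apply, h1, h2,
      Equiv.coe_refl, id_eq]
  simp_rw [h]
  rw [sum_walk N n fun x y => N y x, pow_succ, Matrix.trace]
  simp_rw [Matrix.diag_apply, Matrix.mul_apply, mul_comm]

/-- A labelling of ι is an independent choice of labellings of the cycles, and the weight is
multiplicative over cycles. -/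
theorem sum_walk_eq_prod_orbits {ι : Type*} [Fintype ι] [DecidableEq ι] (σ : Equiv.Perm ι)
    (N : Matrix J J K) [Fintype (Quotient (Equiv.Perm.SameCycle.setoid σ))]
    [DecidableEq (Quotient (Equiv.Perm.SameCycle.setoid σ))] :
    ∑ α : ι → J, ∏ i, N (α i) (α (σ i)) =
      ∏ q : Quotient (Equiv.Perm.SameCycle.setoid σ),
        (N ^ Fintype.card {i // Quotient.mk (Equiv.Perm.SameCycle.setoid σ) i = q}).trace := by
  let f : ι → Quotient (Equiv.Perm.SameCycle.setoid σ) := Quotient.mk _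
  have hf : ∀ i, f (σ i) = f i := fun i => Quotient.sound
    (Equiv.Perm.sameCycle_apply_left.2 (Equiv.Perm.SameCycle.refl σ i))
  let τ : ∀ q, Equiv.Perm {i // f i = q} := fun q => σ.subtypePerm fun i => by rw [hf]
  have hτ : ∀ q, (τ q).IsCycleOn Set.univ := by
    refine fun q => ⟨(τ q).bijective.bijOn_univ, fun x _ y _ => ?_⟩
    have hxy : σ.SameCycle x.1 y.1 := Quotient.exact (x.2.trans y.2.symm)
    exact Equiv.Perm.sameCycle_subtypePerm.2 hxy
  have hne : ∀ q, Nonempty {i // f i = q} := fun q => by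
    obtain ⟨i, hi⟩ := Quotient.exists_rep q
    exact ⟨⟨i, hi⟩⟩
  have h : ∀ q, (N ^ Fintype.card {i : ι // f i = q}).trace =
      ∑ β : {i // f i = q} → J, ∏ i, N (β i) (β (τ q i)) :=
    fun q => (sum_walk_of_isCycleOn (τ q) (hτ q) N).symm
  refine Eq.trans ?_ (Finset.prod_congr rfl fun q _ => (h q).symm)
  rw [Finset.prod_univ_sum]
  simp only [Fintype.piFinset_univ]
  let E : (ι → J) ≃ ∀ q, {i // f i = q} → J :=
    ((Equiv.sigmaFiberEquiv f).symm.arrowCongr (Equiv.refl J)).trans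
      (Equiv.piCurry fun _ _ => J)
  rw [← Equiv.sum_comp E]
  refine Finset.sum_congr rfl fun α _ => ?_
  rw [← Equiv.prod_comp (Equiv.sigmaFiberEquiv f), Fintype.prod_sigma]
  rfl

end

/-- Orbits inside the support correspond to the cycle factors of σ; the remaining ones are fixed
points and give the parts equal to 1. -/
theorem prod_orbits_eq_prod_parts {ι : Type*} [Fintype ι] [DecidableEq ι] (σ : Equiv.Perm ι)
    {M : Type*} [CommMonoid M] (F : ℕ → M)
    [Fintype (Quotient (Equiv.Perm.SameCycle.setoid σ))]
    [DecidableEq (Quotient (Equiv.Perm.SameCycle.setoid σ))] :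
    ∏ q : Quotient (Equiv.Perm.SameCycle.setoid σ),
      F (Fintype.card {i // Quotient.mk (Equiv.Perm.SameCycle.setoid σ) i = q}) =
      (σ.partition.parts.map F).prod := by
  have hmk : ∀ i j, Quotient.mk (Equiv.Perm.SameCycle.setoid σ) i =
      Quotient.mk (Equiv.Perm.SameCycle.setoid σ) j ↔ σ.SameCycle i j := fun i j => Quotient.eq
  have hout : ∀ q : Quotient (Equiv.Perm.SameCycle.setoid σ), Quotient.mk _ q.out = q :=
    Quotient.out_eq
  have hsame : ∀ i, σ.SameCycle (Quotient.mk (Equiv.Perm.SameCycle.setoid σ) i).out i :=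
    fun i => (hmk _ _).1 (hout _)
  rw [Equiv.Perm.parts_partition, Multiset.map_add, Multiset.prod_add, Multiset.map_replicate,
    Multiset.prod_replicate, Equiv.Perm.cycleType_def, Multiset.map_map,
    ← Finset.prod_filter_mul_prod_filter_not Finset.univ
      (fun q : Quotient (Equiv.Perm.SameCycle.setoid σ) => q.out ∈ σ.support)]
  congr 1
  · refine Finset.prod_bij (fun q _ => σ.cycleOf q.out) ?_ ?_ ?_ ?_
    · intro q hq
      exact Equiv.Perm.cycleOf_mem_cycleFactorsFinset_iff.2 (Finset.mem_filter.1 hq).2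
    · intro q hq q' hq' h
      rw [← hout q, ← hout q', hmk]
      have h2 : q'.out ∈ (σ.cycleOf q'.out).support :=
        Equiv.Perm.mem_support_cycleOf_iff.2
          ⟨Equiv.Perm.SameCycle.refl _ _, (Finset.mem_filter.1 hq').2⟩
      rw [← h] at h2
      exact (Equiv.Perm.mem_support_cycleOf_iff.1 h2).1
    · intro c hc
      obtain ⟨hcyc, hcσ⟩ := Equiv.Perm.mem_cycleFactorsFinset_iff.1 hc
      obtain ⟨i, hi⟩ := hcyc.nonempty_support
      have hci := Equiv.Perm.cycle_is_cycleOf hi hc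
      have hiσ : i ∈ σ.support := Equiv.Perm.mem_cycleFactorsFinset_support_le hc hi
      refine ⟨Quotient.mk _ i, Finset.mem_filter.2 ⟨Finset.mem_univ _, ?_⟩, ?_⟩
      · exact (hsame i).mem_support_iff.2 hiσ
      · rw [hci]
        exact (hsame i).cycleOf_eq
    · intro q hq
      rw [Function.comp_apply, Function.comp_apply, Fintype.card_subtype]
      congr 2
      ext i
      rw [Equiv.Perm.mem_support_cycleOf_iff, Finset.mem_filter, ← hout q, hmk, hout]
      exact ⟨fun h => ⟨h.2.symm, (Finset.mem_filter.1 hq).2⟩, fun h => ⟨Finset.mem_univ _, h.1.symm⟩⟩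
  · have hfix : ∀ i, i ∉ σ.support → ∀ j, σ.SameCycle i j → i = j := by
      rintro i hi j ⟨n, rfl⟩
      rw [Equiv.Perm.notMem_support] at hi
      exact (Equiv.Perm.zpow_apply_eq_self_of_apply_eq_self hi n).symm
    have hcard : (Finset.univ.filter fun q : Quotient (Equiv.Perm.SameCycle.setoid σ) =>
        ¬ q.out ∈ σ.support).card = Fintype.card ι - σ.support.card := by
      rw [← Finset.card_compl]
      refine Finset.card_bij (fun q _ => q.out) ?_ ?_ ?_
      · intro q hq
        exact Finset.mem_compl.2 (Finset.mem_filter.1 hq).2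
      · intro q _ q' _ h
        rw [← hout q, ← hout q', h]
      · intro i hi
        have hi' := hfix i (Finset.mem_compl.1 hi) _ (hsame i).symm
        refine ⟨Quotient.mk _ i, Finset.mem_filter.2 ⟨Finset.mem_univ _, ?_⟩, hi'.symm⟩
        rw [← hi']
        exact Finset.mem_compl.1 hi
    rw [← hcard, ← Finset.prod_const]
    refine Finset.prod_congr rfl fun q hq => ?_
    congr 1
    rw [Fintype.card_eq_one_iff]
    refine ⟨⟨q.out, hout q⟩, fun j => Subtype.ext ?_⟩
    refine (hfix _ (Finset.mem_filter.1 hq).2 _ ((hmk _ _).1 ?_)).symm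
    rw [hout, j.2]

theorem sum_walk_eq_prod_parts {K : Type*} [CommRing K] {J : Type*} [Fintype J] [DecidableEq J]
    {ι : Type*} [Fintype ι] [DecidableEq ι] (σ : Equiv.Perm ι) (N : Matrix J J K) :
    ∑ α : ι → J, ∏ i, N (α i) (α (σ i)) = (σ.partition.parts.map fun k => (N ^ k).trace).prod := by
  classical
  rw [sum_walk_eq_prod_orbits, prod_orbits_eq_prod_parts σ fun k => (N ^ k).trace]

/-! ### Traces on tensor powers -/

section

variable {K : Type u} [Field K] {V W : Type u} [AddCommGroup V] [Module K V] [AddCommGroup W]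
  [Module K W]

/-- The tensor power of a linear map. -/
def tensorMap (r : ℕ) (h : V →ₗ[K] W) : (⨂[K]^r V) →ₗ[K] (⨂[K]^r W) :=
  PiTensorProduct.map fun _ => h

theorem permTensor_tprod (r : ℕ) (σ : Equiv.Perm (Fin r)) (v : Fin r → V) :
    permTensor K V r σ (PiTensorProduct.tprod K v) =
      PiTensorProduct.tprod K fun i => v (σ.symm i) :=
  PiTensorProduct.reindex_tprod σ v

theorem trace_permTensor_comp_tensorMap [Module.Finite K V] (r : ℕ) (σ : Equiv.Perm (Fin r))
    (h : V →ₗ[K] V) :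
    LinearMap.trace K _ (permTensor K V r σ ∘ₗ tensorMap r h) =
      (σ.partition.parts.map fun k => LinearMap.trace K V (h ^ k)).prod := by
  classical
  let b := Module.finBasis K V
  -- The diagonal coefficient at α is a product of entries of the matrix of h in row α(σ i), column
  -- α(i); transposing puts the walk in the order i, σ i.
  let N : Matrix _ _ K := (LinearMap.toMatrix b b h).transpose
  have hN : ∀ k, (N ^ k).trace = LinearMap.trace K V (h ^ k) := by
    intro k
    rw [← Matrix.transpose_pow, Matrix.trace_transpose, LinearMap.trace_eq_matrix_trace K b,
      LinearMap.toMatrix_pow]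
  simp_rw [← hN]
  rw [← sum_walk_eq_prod_parts,
    LinearMap.trace_eq_matrix_trace K (Basis.piTensorProduct fun _ : Fin r => b), Matrix.trace]
  refine Finset.sum_congr rfl fun α _ => ?_
  rw [Matrix.diag_apply, LinearMap.toMatrix_apply, LinearMap.comp_apply,
    Basis.piTensorProduct_apply, tensorMap, PiTensorProduct.map_tprod, permTensor_tprod,
    Basis.piTensorProduct_repr_tprod_apply, ← Equiv.prod_comp σ]
  refine Finset.prod_congr rfl fun i _ => ?_
  rw [Equiv.symm_apply_apply]
  exact (LinearMap.toMatrix_apply b b h _ _).symm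

end

/-! ### Sizes of conjugacy classes -/

theorem expOf_prod_eq_prod_toFinset {M : Type*} [CommMonoid M] (s : Multiset ℕ)
    (hs : ∀ k ∈ s, 0 < k) (g : ℕ → ℕ → M) :
    ((expOf s).prod fun k e => g k e) = ∏ k ∈ s.toFinset, g k (s.count k) := by
  refine Finset.prod_bij (fun k _ => (k : ℕ)) ?_ ?_ ?_ ?_
  · intro k hk
    rw [Finsupp.mem_support_iff, expOf_apply] at hk
    simpa using hk
  · intro k _ j _ h
    exact PNat.coe_injective h
  · intro k hk
    have hk' := Multiset.mem_toFinset.1 hk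
    lift k to ℕ+ using hs k hk'
    exact ⟨k, by simpa [expOf_apply] using hk', rfl⟩
  · intro k _
    rw [expOf_apply]

theorem zee_expOf (s : Multiset ℕ) (hs : ∀ k ∈ s, 0 < k) :
    zee (expOf s) = s.prod * ∏ k ∈ s.toFinset, (s.count k).factorial := by
  rw [zee, Finsupp.prod_mul, expOf_prod (fun k => k) s hs, Multiset.map_id',
    expOf_prod_eq_prod_toFinset s hs fun _ e => e.factorial]

/-- z_λ is the order of the centralizer of a permutation of cycle type λ. -/
theorem zee_mul_card {d : ℕ} (l : d.Partition) :
    zee (expOf l.parts) *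
      (Finset.univ.filter fun σ : Equiv.Perm (Fin d) => σ.partition.parts = l.parts).card =
      d.factorial := by
  -- `Equiv.Perm.cycleType` omits fixed points, so the parts equal to 1 are treated apart; they
  -- account for the factor (d - m.sum)!.
  set m := l.parts.filter (2 ≤ ·) with hm
  have hsplit : l.parts = m + Multiset.replicate (l.parts.count 1) 1 := by
    conv_lhs => rw [← Multiset.filter_add_not (2 ≤ ·) l.parts]
    congr 1
    rw [← Multiset.filter_eq' l.parts 1]
    refine Multiset.filter_congr fun k hk => ?_
    have := l.parts_pos hk
    omega
  have hsum : m.sum + l.parts.count 1 = d := by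
    have := congrArg Multiset.sum hsplit
    rw [l.parts_sum, Multiset.sum_add, Multiset.sum_replicate] at this
    simpa using this.symm
  have hiff : ∀ σ : Equiv.Perm (Fin d), σ.partition.parts = l.parts ↔ σ.cycleType = m := by
    intro σ
    constructor
    · intro h
      rw [← Equiv.Perm.filter_parts_partition_eq_cycleType, h, hm]
    · intro h
      rw [Equiv.Perm.parts_partition, hsplit, h, ← Equiv.Perm.sum_cycleType, h, Fintype.card_fin]
      congr 2
      omega
  simp_rw [hiff]
  have h := Equiv.Perm.card_of_cycleType_mul_eq (Fin d) m
  rw [if_pos ⟨by rw [Fintype.card_fin]; omega, fun a ha => (Multiset.mem_filter.1 ha).2⟩,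
    Fintype.card_fin] at h
  rw [← h, mul_comm]
  congr 1
  rw [zee_expOf _ fun k hk => l.parts_pos hk, show d - m.sum = l.parts.count 1 by omega]
  have hprod : l.parts.prod = m.prod := by
    conv_lhs => rw [hsplit]
    rw [Multiset.prod_add, Multiset.prod_replicate, one_pow, mul_one]
  rw [hprod, mul_assoc, mul_left_comm]
  congr 1
  rw [← Finset.prod_filter_mul_prod_filter_not l.parts.toFinset (2 ≤ ·), mul_comm]
  congr 1
  · rw [Finset.prod_subset (s₂ := {1})]
    · simp
    · intro k hk
      rw [Finset.mem_filter, Multiset.mem_toFinset] at hk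
      have := l.parts_pos hk.1
      rw [Finset.mem_singleton]
      omega
    · intro k hk hk'
      rw [Finset.mem_singleton] at hk
      subst hk
      have : 1 ∉ l.parts := fun h => hk' (by simpa using h)
      rw [Multiset.count_eq_zero_of_notMem this, Nat.factorial_zero]
  · rw [hm, Multiset.toFinset_filter]
    refine Finset.prod_congr rfl fun k hk => ?_
    rw [Multiset.count_filter_of_pos (Finset.mem_filter.1 hk).2]

/-! ### Polynomial maps and their polarizations -/

section

variable {K : Type u} [Field K]
  {X Y X' Y' : Type*} [AddCommGroup X] [Module K X] [AddCommGroup Y] [Module K Y]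
  [AddCommGroup X'] [Module K X'] [AddCommGroup Y'] [Module K Y']

/-- A map that is a linear combination, with coefficients in a vector space, of monomials in linear
functionals. -/
def IsPolyMap (f : X → Y) : Prop :=
  ∃ (n : ℕ) (l : Fin n → X →ₗ[K] K) (J : Type) (_ : Fintype J) (m : J → Fin n → ℕ) (c : J → Y),
    ∀ x, f x = ∑ j, (∏ i, l i x ^ m j i) • c j

/-- A map that is a finite sum of homogeneous maps given by multilinear maps. -/
def IsSumOfHomogeneous (K : Type u) [Field K] {X Y : Type*} [AddCommGroup X] [Module K X]
    [AddCommGroup Y] [Module K Y] (f : X → Y) : Prop :=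
  ∃ (D : ℕ) (M : ∀ k, MultilinearMap K (fun _ : Fin k => X) Y),
    (∀ k, D ≤ k → M k = 0) ∧ ∀ x, f x = ∑ k ∈ Finset.range D, M k fun _ => x

theorem isSumOfHomogeneous_multilinear {k : ℕ} (N : MultilinearMap K (fun _ : Fin k => X) Y) :
    IsSumOfHomogeneous K fun x => N fun _ => x := by
  refine ⟨k + 1, fun j => if h : k = j then N.domDomCongr (finCongr h) else 0, ?_, ?_⟩
  · intro j hj
    exact dif_neg (by omega)
  · intro x
    rw [Finset.sum_eq_single k]
    · dsimp only
      rw [dif_pos rfl]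
      rfl
    · intro j _ hj
      dsimp only
      rw [dif_neg hj.symm]
      rfl
    · intro h
      exact absurd (Finset.mem_range.2 k.lt_succ_self) h

theorem isSumOfHomogeneous_zero : IsSumOfHomogeneous K fun _ : X => (0 : Y) :=
  ⟨0, fun _ => 0, fun _ _ => rfl, fun _ => by simp⟩

theorem IsSumOfHomogeneous.add {f g : X → Y} (hf : IsSumOfHomogeneous K f)
    (hg : IsSumOfHomogeneous K g) : IsSumOfHomogeneous K fun x => f x + g x := by
  obtain ⟨D, M, hM, hf⟩ := hf
  obtain ⟨E, N, hN, hg⟩ := hg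
  refine ⟨max D E, fun k => M k + N k, fun k hk => ?_, fun x => ?_⟩
  · dsimp only
    rw [hM k (le_of_max_le_left hk), hN k (le_of_max_le_right hk), add_zero]
  · simp only [add_apply, Finset.sum_add_distrib]
    rw [hf, hg]
    congr 1
    · refine Finset.sum_subset (Finset.range_mono (le_max_left _ _)) fun k _ hk => ?_
      rw [hM k (by simpa using hk)]
      rfl
    · refine Finset.sum_subset (Finset.range_mono (le_max_right _ _)) fun k _ hk => ?_
      rw [hN k (by simpa using hk)]
      rfl

theorem IsSumOfHomogeneous.sum {ι : Type*} (s : Finset ι) {f : ι → X → Y}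
    (hf : ∀ i, IsSumOfHomogeneous K (f i)) : IsSumOfHomogeneous K fun x => ∑ i ∈ s, f i x := by
  classical
  induction s using Finset.induction_on with
  | empty => simpa using isSumOfHomogeneous_zero
  | insert i s hi ih =>
    simp_rw [Finset.sum_insert hi]
    exact (hf i).add ih

theorem IsPolyMap.isSumOfHomogeneous {f : X → Y} (hf : IsPolyMap (K := K) f) :
    IsSumOfHomogeneous K f := by
  obtain ⟨n, l, J, _, m, c, hf⟩ := hf
  rw [show f = fun x => ∑ j, (∏ i, l i x ^ m j i) • c j from funext hf]
  refine IsSumOfHomogeneous.sum _ fun j => ?_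
  -- The monomial is a product of functionals, with l_i repeated m j i times.
  let e := Fintype.equivFin (Σ i, Fin (m j i))
  let N : MultilinearMap K (fun _ : Fin (Fintype.card (Σ i, Fin (m j i))) => X) Y :=
    (LinearMap.toSpanSingleton K Y (c j)).compMultilinearMap
      ((MultilinearMap.mkPiAlgebra K (Fin (Fintype.card (Σ i, Fin (m j i)))) K).compLinearMap
        fun s => l (e.symm s).1)
  have hN : (fun x => (∏ i, l i x ^ m j i) • c j) = fun x => N fun _ => x := by
    funext x
    simp only [N, LinearMap.compMultilinearMap_apply, MultilinearMap.compLinearMap_apply,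
      MultilinearMap.mkPiAlgebra_apply, LinearMap.toSpanSingleton_apply]
    rw [Equiv.prod_comp e.symm fun s => l s.1 x, Fintype.prod_sigma]
    simp
  rw [hN]
  exact isSumOfHomogeneous_multilinear N

/-- The symmetrization of the components of a vanishing polynomial map vanishes. -/
theorem sum_perm_eq_zero [Infinite K] {D : ℕ} {M : ∀ k, MultilinearMap K (fun _ : Fin k => X) Y}
    (hM : ∀ k, D ≤ k → M k = 0) (h : ∀ x, ∑ k ∈ Finset.range D, M k (fun _ => x) = 0) (d : ℕ)
    (g : Fin d → X) : ∑ π : Equiv.Perm (Fin d), M d (fun i => g (π i)) = 0 := by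
  rw [← Module.forall_dual_apply_eq_zero_iff K]
  intro ψ
  -- This is ψ of the given sum at x = ∑ t_i g_i, expanded in the variables t_i.
  let q : MvPolynomial (Fin d) K := ∑ k ∈ Finset.range D, ∑ α : Fin k → Fin d,
    MvPolynomial.monomial (∑ j, Finsupp.single (α j) 1) (ψ (M k fun j => g (α j)))
  have hq : q = 0 := by
    refine MvPolynomial.funext fun t => ?_
    rw [map_zero, ← map_zero ψ, ← h (∑ i, t i • g i)]
    simp only [q, map_sum]
    refine Finset.sum_congr rfl fun k _ => ?_
    rw [MultilinearMap.map_sum, map_sum]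
    refine Finset.sum_congr rfl fun α _ => ?_
    rw [MultilinearMap.map_smul_univ, map_smul, MvPolynomial.eval_monomial, mul_comm, smul_eq_mul]
    congr 1
    rw [← Finsupp.prod_finsetSum_index (by simp) (by simp [pow_add])]
    simp
  -- The monomial t_1 ⋯ t_d arises only for k = d and bijective α, where the coefficients add up to
  -- the symmetrization.
  have h1 := congrArg (MvPolynomial.coeff (∑ i : Fin d, Finsupp.single i 1)) hq
  rw [MvPolynomial.coeff_zero, MvPolynomial.coeff_sum] at h1
  rw [map_sum, ← h1, Finset.sum_eq_single d]
  · rw [MvPolynomial.coeff_sum]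
    refine Fintype.sum_of_injective (fun π : Equiv.Perm (Fin d) => (π : Fin d → Fin d))
      DFunLike.coe_injective _ _ ?_ ?_
    · intro α hα
      rw [MvPolynomial.coeff_monomial, if_neg]
      intro heq
      refine hα ?_
      have hsurj : Function.Surjective α := by
        intro i
        by_contra! hi
        have := DFunLike.congr_fun heq i
        rw [Finsupp.finsetSum_apply, Finsupp.finsetSum_apply] at this
        simp [Finsupp.single_apply, hi] at this
      exact ⟨Equiv.ofBijective α (Finite.injective_iff_bijective.1
        (Finite.injective_iff_surjective.2 hsurj)), rfl⟩
    · intro π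
      rw [MvPolynomial.coeff_monomial, if_pos]
      exact Equiv.sum_comp π fun i => Finsupp.single i 1
  · intro k _ hk
    rw [MvPolynomial.coeff_sum]
    refine Finset.sum_eq_zero fun α _ => ?_
    rw [MvPolynomial.coeff_monomial, if_neg]
    intro heq
    have := congrArg Finsupp.degree heq
    simp at this
    exact hk this
  · intro hd
    rw [hM d (by simpa using hd)]
    simp

/-- The polarization of the component of degree `d` of a polynomial map. -/
def polar {f : X → Y} (hf : IsSumOfHomogeneous K f) (d : ℕ) :
    MultilinearMap K (fun _ : Fin d => X) Y :=
  ∑ π : Equiv.Perm (Fin d), (hf.choose_spec.choose d).domDomCongr π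

/-- A bound for the degree of a polynomial map. -/
def degreeBound {f : X → Y} (hf : IsSumOfHomogeneous K f) : ℕ := hf.choose

theorem polar_apply {f : X → Y} (hf : IsSumOfHomogeneous K f) (d : ℕ) (g : Fin d → X) :
    polar hf d g = ∑ π : Equiv.Perm (Fin d), hf.choose_spec.choose d fun i => g (π i) := by
  rw [polar, sum_apply]
  rfl

theorem polar_eq_zero {f : X → Y} (hf : IsSumOfHomogeneous K f) {d : ℕ} (hd : degreeBound hf ≤ d) :
    polar hf d = 0 := by
  ext g
  rw [polar_apply, hf.choose_spec.choose_spec.1 d hd]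
  simp

/-- `polar` sums over d! permutations without dividing, so recovering f requires 1/d!. -/
theorem eq_sum_polar [CharZero K] {f : X → Y} (hf : IsSumOfHomogeneous K f) (x : X) :
    f x = ∑ d ∈ Finset.range (degreeBound hf),
      ((d.factorial : ℕ) : K)⁻¹ • polar hf d fun _ => x := by
  rw [hf.choose_spec.choose_spec.2 x]
  refine Finset.sum_congr rfl fun d _ => ?_
  rw [polar_apply, Finset.sum_const, Finset.card_univ, Fintype.card_perm, Fintype.card_fin,
    ← Nat.cast_smul_eq_nsmul K, smul_smul,
    inv_mul_cancel₀ (Nat.cast_ne_zero.2 d.factorial_ne_zero), one_smul]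

/-- The multilinear maps chosen for f are not unique, but their symmetrizations are determined by f.
Hence any linear relation between polynomial maps passes to polarizations. -/
theorem polar_eq_of_forall [Infinite K] {f : X → Y} (hf : IsSumOfHomogeneous K f) (L : Y →ₗ[K] Y')
    {D : ℕ} {N : ∀ k, MultilinearMap K (fun _ : Fin k => X) Y'} (hN : ∀ k, D ≤ k → N k = 0)
    (h : ∀ x, L (f x) = ∑ k ∈ Finset.range D, N k fun _ => x) (d : ℕ) (g : Fin d → X) :
    L (polar hf d g) = ∑ π : Equiv.Perm (Fin d), N d fun i => g (π i) := by
  have hM := hf.choose_spec.choose_spec.1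
  have hx := hf.choose_spec.choose_spec.2
  rw [polar_apply, map_sum]
  set E := hf.choose
  set M := hf.choose_spec.choose
  rw [← sub_eq_zero, ← Finset.sum_sub_distrib]
  refine sum_perm_eq_zero (D := max E D) (M := fun k => L.compMultilinearMap (M k) - N k) ?_ ?_ d g
  · intro k hk
    rw [hM k (le_of_max_le_left hk), hN k (le_of_max_le_right hk)]
    ext
    simp
  · intro x
    simp only [sub_apply, LinearMap.compMultilinearMap_apply,
      Finset.sum_sub_distrib]
    rw [sub_eq_zero, ← map_sum]
    have h1 : ∑ k ∈ Finset.range (max E D), (M k fun _ => x) = f x := by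
      rw [hx]
      refine (Finset.sum_subset (Finset.range_mono (le_max_left _ _)) fun k _ hk => ?_).symm
      rw [hM k (by simpa using hk)]
      rfl
    rw [h1, h]
    refine Finset.sum_subset (Finset.range_mono (le_max_right _ _)) fun k _ hk => ?_
    rw [hN k (by simpa using hk)]
    rfl

theorem polar_map [Infinite K] {f : X → Y} {f' : X' → Y'} (hf : IsSumOfHomogeneous K f)
    (hf' : IsSumOfHomogeneous K f') (l : X →ₗ[K] X') (L : Y →ₗ[K] Y')
    (h : ∀ x, L (f x) = f' (l x)) (d : ℕ) (g : Fin d → X) :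
    L (polar hf d g) = polar hf' d fun i => l (g i) := by
  rw [polar_eq_of_forall hf L (D := hf'.choose)
    (N := fun k => (hf'.choose_spec.choose k).compLinearMap fun _ => l), polar_apply]
  · rfl
  · intro k hk
    rw [hf'.choose_spec.choose_spec.1 k hk]
    rfl
  · intro x
    rw [h]
    exact hf'.choose_spec.choose_spec.2 (l x)

theorem polar_eq_of_multilinear [Infinite K] {f : X → Y} (hf : IsSumOfHomogeneous K f)
    (L : Y →ₗ[K] Y') {d : ℕ} (N : MultilinearMap K (fun _ : Fin d => X) Y')
    (h : ∀ x, L (f x) = N fun _ => x) (g : Fin d → X) :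
    L (polar hf d g) = ∑ π : Equiv.Perm (Fin d), N fun i => g (π i) := by
  rw [polar_eq_of_forall hf L (D := d + 1)
    (N := fun j => if h : d = j then N.domDomCongr (finCongr h) else 0)]
  · simp only [dif_pos]
    rfl
  · intro j hj
    exact dif_neg (by omega)
  · intro x
    rw [h, Finset.sum_eq_single d]
    · rw [dif_pos rfl]
      rfl
    · intro j _ hj
      rw [dif_neg hj.symm]
      rfl
    · intro h
      exact absurd (Finset.mem_range.2 d.lt_succ_self) h

end

/-! ### Polarizations of polynomial functors -/

section

variable {K : Type u} [Field K] {U V W : Type u} [AddCommGroup U] [Module K U] [Module.Finite K U]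
  [AddCommGroup V] [Module K V] [Module.Finite K V] [AddCommGroup W] [Module K W]
  [Module.Finite K W]

/-- The action of a functor on linear maps. -/
def fmap (Q : FGModuleCat.{u} K ⥤ FGModuleCat.{u} K) (f : U →ₗ[K] V) :
    Q.obj (FGModuleCat.of K U) →ₗ[K] Q.obj (FGModuleCat.of K V) :=
  (Q.map (FGModuleCat.ofHom f)).hom.hom

variable {Q : FGModuleCat.{u} K ⥤ FGModuleCat.{u} K}

theorem fmap_comp (g : V →ₗ[K] W) (f : U →ₗ[K] V) :
    fmap Q (g ∘ₗ f) = fmap Q g ∘ₗ fmap Q f := by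
  have h : FGModuleCat.ofHom (g ∘ₗ f) = FGModuleCat.ofHom f ≫ FGModuleCat.ofHom g := rfl
  rw [fmap, h, CategoryTheory.Functor.map_comp]
  rfl

theorem fmap_id : fmap Q (LinearMap.id : V →ₗ[K] V) = LinearMap.id := by
  have : FGModuleCat.ofHom (LinearMap.id : V →ₗ[K] V) = 𝟙 (FGModuleCat.of K V) := rfl
  rw [fmap, this, CategoryTheory.Functor.map_id]
  rfl

/-- A natural endomorphism of a functor at a vector space. -/
def natApp (s : Q ⟶ Q) (V : Type u) [AddCommGroup V] [Module K V] [Module.Finite K V] :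
    Q.obj (FGModuleCat.of K V) →ₗ[K] Q.obj (FGModuleCat.of K V) :=
  (s.app (FGModuleCat.of K V)).hom.hom

theorem natApp_comp_fmap (s : Q ⟶ Q) (f : U →ₗ[K] V) :
    natApp s V ∘ₗ fmap Q f = fmap Q f ∘ₗ natApp s U :=
  congrArg (fun φ => φ.hom.hom) (s.naturality (FGModuleCat.ofHom f))

/-- The maps `Hom(U, V) → Hom(Q U, Q V)` are finite sums of homogeneous maps. -/
def IsPolyFunctor (Q : FGModuleCat.{u} K ⥤ FGModuleCat.{u} K) : Prop :=
  ∀ (U V : Type u) [AddCommGroup U] [Module K U] [Module.Finite K U] [AddCommGroup V] [Module K V]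
    [Module.Finite K V], IsSumOfHomogeneous K fun f : U →ₗ[K] V => fmap Q f

/-- The polarization of the component of degree `d` of a polynomial functor. -/
def polarMap (hQ : IsPolyFunctor Q) (d : ℕ) :
    MultilinearMap K (fun _ : Fin d => U →ₗ[K] V)
      (Q.obj (FGModuleCat.of K U) →ₗ[K] Q.obj (FGModuleCat.of K V)) :=
  polar (hQ U V) d

section

variable (hQ : IsPolyFunctor Q) (d : ℕ)

/-- The map `T^d(V) → Q(V)` that takes `v₁ ⊗ ⋯ ⊗ v_d` to the value at `x` of the polarization of `Q`
at the maps `K^d → V`, `e_i ↦ v_i`. -/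
def inMap (x : Q.obj (FGModuleCat.of K (Fin d → K))) :
    (⨂[K]^d V) →ₗ[K] Q.obj (FGModuleCat.of K V) :=
  PiTensorProduct.lift ((LinearMap.applyₗ x).compMultilinearMap
    ((polarMap hQ d).compLinearMap fun i => LinearMap.smulRightₗ (LinearMap.proj i)))

theorem inMap_tprod (x : Q.obj (FGModuleCat.of K (Fin d → K))) (v : Fin d → V) :
    inMap hQ d x (PiTensorProduct.tprod K v) =
      polarMap hQ d (fun i => (LinearMap.proj i).smulRight (v i)) x := by
  rw [inMap, PiTensorProduct.lift.tprod]
  rfl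

/-- The map `Q(V) → T^d(V)` whose coordinates are given by the polarization of `Q` at maps
`V → K^d`, followed by `ξ`. -/
def outMap (ξ : Module.Dual K (Q.obj (FGModuleCat.of K (Fin d → K)))) :
    Q.obj (FGModuleCat.of K V) →ₗ[K] (⨂[K]^d V) :=
  ∑ α : Fin d → Fin (Module.finrank K V),
    (ξ ∘ₗ polarMap hQ d fun i => ((Module.finBasis K V).coord (α i)).smulRight
      (Pi.single i 1 : Fin d → K)).smulRight
      (PiTensorProduct.tprod K fun i => Module.finBasis K V (α i))

/-- The polarization of `Q` at the matrix units `E_{π i, i}`. -/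
def permMap (π : Equiv.Perm (Fin d)) :
    Q.obj (FGModuleCat.of K (Fin d → K)) →ₗ[K] Q.obj (FGModuleCat.of K (Fin d → K)) :=
  polarMap hQ d fun i => (LinearMap.proj i).smulRight (Pi.single (π i) 1 : Fin d → K)

theorem tprod_eq_sum (v : Fin d → V) :
    PiTensorProduct.tprod K v = ∑ α : Fin d → Fin (Module.finrank K V),
      (∏ i, (Module.finBasis K V).coord (α i) (v i)) •
        PiTensorProduct.tprod K fun i => Module.finBasis K V (α i) := by
  conv_lhs => rw [show v = fun i => ∑ c, (Module.finBasis K V).coord c (v i) •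
    Module.finBasis K V c from funext fun i => ((Module.finBasis K V).sum_repr (v i)).symm]
  rw [MultilinearMap.map_sum]
  exact Finset.sum_congr rfl fun α _ => MultilinearMap.map_smul_univ _ _ _

variable [CharZero K]

theorem fmap_comp_polarMap (h : V →ₗ[K] W) (g : Fin d → U →ₗ[K] V) :
    fmap Q h ∘ₗ polarMap hQ d g = polarMap hQ d fun i => h ∘ₗ g i :=
  polar_map (hQ U V) (hQ U W) (LinearMap.llcomp K _ _ _ h) (LinearMap.llcomp K _ _ _ (fmap Q h))
    (fun x => (fmap_comp h x).symm) d g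

theorem polarMap_comp_fmap (g : Fin d → V →ₗ[K] W) (h : U →ₗ[K] V) :
    polarMap hQ d g ∘ₗ fmap Q h = polarMap hQ d fun i => g i ∘ₗ h :=
  polar_map (hQ V W) (hQ U W) (LinearMap.lcomp K _ h) (LinearMap.lcomp K _ (fmap Q h))
    (fun x => (fmap_comp x h).symm) d g

/-- The linear map y ↦ s ∘ y - y ∘ s kills every Q(f) by naturality, hence also the polarizations.
-/
theorem natApp_comp_polarMap (s : Q ⟶ Q) (g : Fin d → U →ₗ[K] V) :
    natApp s V ∘ₗ polarMap hQ d g = polarMap hQ d g ∘ₗ natApp s U := by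
  have h := polar_eq_of_forall (hQ U V)
    (LinearMap.llcomp K _ _ _ (natApp s V) - LinearMap.lcomp K _ (natApp s U)) (D := 0)
    (N := fun _ => 0) (fun _ _ => rfl) (fun x => sub_eq_zero.2 (natApp_comp_fmap s x)) d g
  rw [← sub_eq_zero]
  refine Eq.trans h ?_
  simp

/-- For fixed h, composing Q(x) with the polarization at h gives the polarization at the maps x ∘
h_i, which is multilinear of degree d in x. Polarizing in x produces the sum over permutations. -/
theorem polarMap_comp_polarMap (g : Fin d → V →ₗ[K] W) (h : Fin d → U →ₗ[K] V) :
    polarMap hQ d g ∘ₗ polarMap hQ d h =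
      ∑ π : Equiv.Perm (Fin d), polarMap hQ d fun i => g (π i) ∘ₗ h i :=
  polar_eq_of_multilinear (hQ V W) (LinearMap.lcomp K _ (polarMap hQ d h))
    ((polarMap hQ d).compLinearMap fun i => LinearMap.lcomp K _ (h i))
    (fun x => fmap_comp_polarMap hQ d x h) g

/-- This naturality, with that of `outMap`, is what makes the maps G-equivariant. -/
theorem fmap_comp_inMap (x : Q.obj (FGModuleCat.of K (Fin d → K))) (g : V →ₗ[K] V) :
    fmap Q g ∘ₗ inMap hQ d x = inMap hQ d x ∘ₗ tensorMap d g := by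
  ext v
  simp only [LinearMap.compMultilinearMap_apply, LinearMap.comp_apply, tensorMap,
    PiTensorProduct.map_tprod, inMap_tprod]
  rw [← LinearMap.comp_apply, fmap_comp_polarMap]
  congr 2
  ext i : 1
  ext y
  simp

theorem outMap_comp_fmap (ξ : Module.Dual K (Q.obj (FGModuleCat.of K (Fin d → K))))
    (g : V →ₗ[K] V) : outMap hQ d ξ ∘ₗ fmap Q g = tensorMap d g ∘ₗ outMap hQ d ξ := by
  set b := Module.finBasis K V with hb
  have h1 : ∀ a, b.coord a ∘ₗ g = ∑ c, b.coord a (g (b c)) • b.coord c := by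
    intro a
    refine b.ext fun c => ?_
    simp [Finsupp.single_apply]
  have h2 : ∀ α : Fin d → Fin (Module.finrank K V),
      polarMap hQ d (fun i => (b.coord (α i)).smulRight (Pi.single i 1 : Fin d → K)) ∘ₗ fmap Q g =
      ∑ β : Fin d → Fin (Module.finrank K V), (∏ i, b.coord (α i) (g (b (β i)))) •
        polarMap hQ d fun i => (b.coord (β i)).smulRight (Pi.single i 1 : Fin d → K) := by
    intro α
    rw [polarMap_comp_fmap]
    have : (fun i => (b.coord (α i)).smulRight (Pi.single i 1 : Fin d → K) ∘ₗ g) = fun i =>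
        ∑ c, b.coord (α i) (g (b c)) • (b.coord c).smulRight (Pi.single i 1 : Fin d → K) := by
      funext i
      ext1 y
      have := DFunLike.congr_fun (h1 (α i)) y
      rw [LinearMap.comp_apply] at this
      rw [LinearMap.comp_apply, LinearMap.smulRight_apply, this]
      simp only [LinearMap.sum_apply, LinearMap.smul_apply, LinearMap.smulRight_apply,
        Finset.sum_smul, smul_assoc]
    rw [this, MultilinearMap.map_sum]
    exact Finset.sum_congr rfl fun β _ => MultilinearMap.map_smul_univ _ _ _
  ext u
  simp only [outMap, LinearMap.comp_apply, LinearMap.sum_apply, LinearMap.smulRight_apply, map_sum,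
    map_smul, tensorMap, PiTensorProduct.map_tprod]
  have h3 : ∀ α, _ = _ := fun α => congrArg ξ (DFunLike.congr_fun (h2 α) u)
  simp only [LinearMap.comp_apply, LinearMap.sum_apply, LinearMap.smul_apply, map_sum,
    map_smul] at h3
  rw [← hb]
  simp_rw [h3, Finset.sum_smul]
  rw [Finset.sum_comm]
  refine Finset.sum_congr rfl fun β _ => ?_
  rw [tprod_eq_sum d fun i => g (b (β i)), Finset.smul_sum]
  refine Finset.sum_congr rfl fun α _ => ?_
  rw [smul_eq_mul, mul_comm, mul_smul]

/-- Composing the two polarizations through V gives multiples of the matrix units E_{π i, i}, so the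
V-dependence reduces to the permutation π of the tensor factors. -/
theorem outMap_comp_inMap (s : Q ⟶ Q) (x : Q.obj (FGModuleCat.of K (Fin d → K)))
    (ξ : Module.Dual K (Q.obj (FGModuleCat.of K (Fin d → K)))) :
    outMap hQ d ξ ∘ₗ natApp s V ∘ₗ inMap hQ d x =
      ∑ π : Equiv.Perm (Fin d), ξ (permMap hQ d π (natApp s (Fin d → K) x)) •
        permTensor K V d π := by
  set b := Module.finBasis K V with hb
  ext v
  simp only [LinearMap.compMultilinearMap_apply, LinearMap.comp_apply, LinearMap.sum_apply,
    LinearMap.smul_apply, permTensor_tprod, inMap_tprod]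
  rw [← LinearMap.comp_apply (natApp s V), natApp_comp_polarMap, LinearMap.comp_apply]
  set y := natApp s (Fin d → K) x
  have h1 : ∀ α : Fin d → Fin (Module.finrank K V),
      polarMap hQ d (fun i => (b.coord (α i)).smulRight (Pi.single i 1 : Fin d → K))
        (polarMap hQ d (fun i => (LinearMap.proj i).smulRight (v i)) y) =
      ∑ π : Equiv.Perm (Fin d), (∏ i, b.coord (α (π i)) (v i)) • permMap hQ d π y := by
    intro α
    rw [← LinearMap.comp_apply, polarMap_comp_polarMap, LinearMap.sum_apply]
    refine Finset.sum_congr rfl fun π _ => ?_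
    rw [permMap, ← LinearMap.smul_apply, ← MultilinearMap.map_smul_univ]
    congr 2
    funext i
    refine LinearMap.ext fun z => ?_
    simp [smul_smul, mul_comm]
  rw [outMap, LinearMap.sum_apply]
  simp only [LinearMap.smulRight_apply, LinearMap.comp_apply, ← hb, h1, map_sum, map_smul,
    Finset.sum_smul]
  rw [Finset.sum_comm]
  refine Finset.sum_congr rfl fun π _ => ?_
  rw [tprod_eq_sum, Finset.smul_sum]
  refine Finset.sum_congr rfl fun α _ => ?_
  -- Reindexing by π⁻¹ turns the coefficient into the coordinate at α of the permuted tensor.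
  rw [smul_eq_mul, mul_comm, mul_smul, ← Equiv.prod_comp π.symm]
  simp only [Equiv.apply_symm_apply, ← hb]

theorem sum_inMap_comp_outMap {κ : Type*} [Fintype κ]
    (c : Module.Basis κ K (Q.obj (FGModuleCat.of K (Fin d → K)))) :
    ∑ j, inMap hQ d (c j) ∘ₗ outMap (V := V) hQ d (c.coord j) =
      polarMap hQ d fun _ => LinearMap.id := by
  classical
  set b := Module.finBasis K V with hb
  have h1 : ∀ α : Fin d → Fin (Module.finrank K V),
      polarMap hQ d (fun i => (LinearMap.proj i : (Fin d → K) →ₗ[K] K).smulRight (b (α i))) ∘ₗ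
        polarMap hQ d (fun i => (b.coord (α i)).smulRight (Pi.single i 1 : Fin d → K)) =
      polarMap hQ d fun i => (b.coord (α i)).smulRight (b (α i)) := by
    intro α
    rw [polarMap_comp_polarMap, Finset.sum_eq_single 1]
    · congr 1
      funext i
      ext1 z
      simp
    -- If π i ≠ i, the composite in slot i contains the coordinate π i of e_i, which is zero.
    · intro π _ hπ
      obtain ⟨i, hi⟩ : ∃ i, π i ≠ i := by
        by_contra! h
        exact hπ (Equiv.ext h)
      refine MultilinearMap.map_coord_zero _ i ?_
      ext1 z
      simp [hi]
    · exact fun h => absurd (Finset.mem_univ _) h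
  have h2 : (LinearMap.id : V →ₗ[K] V) = ∑ a, (b.coord a).smulRight (b a) := by
    ext z
    simp only [LinearMap.id_apply, LinearMap.sum_apply, LinearMap.smulRight_apply]
    exact (b.sum_repr z).symm
  rw [h2, MultilinearMap.map_sum]
  simp_rw [← h1]
  ext u
  simp only [LinearMap.sum_apply, LinearMap.comp_apply, outMap, LinearMap.smulRight_apply, map_sum,
    map_smul, inMap_tprod, ← hb]
  rw [Finset.sum_comm]
  refine Finset.sum_congr rfl fun α _ => ?_
  simp_rw [← map_smul]
  rw [← map_sum]
  congr 1
  exact c.sum_repr _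

end

end

theorem sum_coord_apply {K : Type*} [Field K] {E : Type*} [AddCommGroup E] [Module K E]
    {κ : Type*} [Fintype κ] (c : Module.Basis κ K E) (L : E →ₗ[K] E) :
    ∑ j, c.coord j (L (c j)) = LinearMap.trace K E L := by
  classical
  rw [LinearMap.trace_eq_matrix_trace K c, Matrix.trace]
  exact Finset.sum_congr rfl fun j _ => (LinearMap.toMatrix_apply c c L j j).symm

theorem sum_comp_right {K : Type*} [Field K] {E E' E'' : Type*} [AddCommGroup E] [Module K E]
    [AddCommGroup E'] [Module K E'] [AddCommGroup E''] [Module K E''] {κ : Type*} (t : Finset κ)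
    (f : κ → E' →ₗ[K] E'') (g : E →ₗ[K] E') : (∑ i ∈ t, f i) ∘ₗ g = ∑ i ∈ t, f i ∘ₗ g :=
  map_sum (LinearMap.lcomp K E'' g) f t

theorem sum_comp_left {K : Type*} [Field K] {E E' E'' : Type*} [AddCommGroup E] [Module K E]
    [AddCommGroup E'] [Module K E'] [AddCommGroup E''] [Module K E''] {κ : Type*} (t : Finset κ)
    (g : E' →ₗ[K] E'') (f : κ → E →ₗ[K] E') : g ∘ₗ ∑ i ∈ t, f i = ∑ i ∈ t, g ∘ₗ f i :=
  map_sum (LinearMap.llcomp K E E' E'' g) f t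

/-! ### Traces on the values of a polynomial functor -/

section

variable {K : Type u} [Field K] [CharZero K] {V : Type u} [AddCommGroup V] [Module K V]
  [Module.Finite K V] {Q : FGModuleCat.{u} K ⥤ FGModuleCat.{u} K}

/-- The coefficient of the permutation `π` of `d` letters in the character of `(Q, s)`. -/
def permCoeff (hQ : IsPolyFunctor Q) (s : Q ⟶ Q) (d : ℕ) (π : Equiv.Perm (Fin d)) : K :=
  LinearMap.trace K _ (permMap hQ d π ∘ₗ natApp s (Fin d → K))

theorem sum_outMap_comp_inMap (hQ : IsPolyFunctor Q) (s : Q ⟶ Q) (d : ℕ) {κ : Type*} [Fintype κ]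
    (c : Module.Basis κ K (Q.obj (FGModuleCat.of K (Fin d → K)))) :
    ∑ j, outMap (V := V) hQ d (c.coord j) ∘ₗ natApp s V ∘ₗ inMap hQ d (c j) =
      ∑ π, permCoeff hQ s d π • permTensor K V d π := by
  simp_rw [outMap_comp_inMap]
  rw [Finset.sum_comm]
  refine Finset.sum_congr rfl fun π _ => ?_
  rw [← Finset.sum_smul, permCoeff, ← sum_coord_apply c]
  rfl

/-- Naturality moves g through the in maps, and cyclicity of the trace exchanges in ∘ out on Q(V)
for out ∘ s ∘ in on T^d(V). -/
theorem sum_permCoeff_mul_trace (hQ : IsPolyFunctor Q) (s : Q ⟶ Q) (d : ℕ) (g : V →ₗ[K] V) :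
    ∑ π, permCoeff hQ s d π * LinearMap.trace K _ (permTensor K V d π ∘ₗ tensorMap d g) =
      LinearMap.trace K _
        ((polarMap hQ d fun _ => LinearMap.id) ∘ₗ natApp s V ∘ₗ fmap Q g) := by
  let c := Module.finBasis K (Q.obj (FGModuleCat.of K (Fin d → K)))
  rw [← sum_inMap_comp_outMap hQ d c, sum_comp_right, map_sum]
  have h : ∀ j, LinearMap.trace K _ ((inMap hQ d (c j) ∘ₗ outMap (V := V) hQ d (c.coord j)) ∘ₗ
      natApp s V ∘ₗ fmap Q g) = LinearMap.trace K _
      ((outMap (V := V) hQ d (c.coord j) ∘ₗ natApp s V ∘ₗ inMap hQ d (c j)) ∘ₗ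
        tensorMap d g) := by
    intro j
    rw [LinearMap.comp_assoc, LinearMap.trace_comp_comm', LinearMap.comp_assoc,
      LinearMap.comp_assoc, fmap_comp_inMap]
    rfl
  simp_rw [h]
  rw [← map_sum, ← sum_comp_right, sum_outMap_comp_inMap, sum_comp_right, map_sum]
  refine Finset.sum_congr rfl fun π _ => ?_
  rw [LinearMap.smul_comp, map_smul, smul_eq_mul]

end

/-! ### Precomposition with equivariant maps -/

section

variable {K A E E' W : Type u} [Field K] [CommRing A] [Algebra K A] [AddCommGroup E] [Module K E]
  [AddCommGroup E'] [Module K E'] [AddCommGroup W] [Module K W]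

theorem mem_homG {θ : E →ₗ[K] E ⊗[K] A} {θ' : E' →ₗ[K] E' ⊗[K] A} {f : E →ₗ[K] E'} :
    f ∈ homG θ θ' ↔ θ' ∘ₗ f = f.rTensor A ∘ₗ θ := Iff.rfl

/-- Precomposition with an equivariant map. -/
def precomp (θ : E →ₗ[K] E ⊗[K] A) (θ' : E' →ₗ[K] E' ⊗[K] A) (τ : W →ₗ[K] W ⊗[K] A) :
    homG θ θ' →ₗ[K] homG θ' τ →ₗ[K] homG θ τ :=
  LinearMap.mk₂ K (fun f φ => ⟨φ.1 ∘ₗ f.1, by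
      rw [mem_homG, ← LinearMap.comp_assoc, mem_homG.1 φ.2, LinearMap.comp_assoc, mem_homG.1 f.2,
        ← LinearMap.comp_assoc, ← LinearMap.rTensor_comp]⟩)
    (fun f g φ => Subtype.ext (LinearMap.comp_add f.1 g.1 φ.1))
    (fun c f φ => Subtype.ext (LinearMap.comp_smul φ.1 c f.1))
    (fun f φ ψ => Subtype.ext (LinearMap.add_comp f.1 ψ.1 φ.1))
    (fun c f φ => Subtype.ext (LinearMap.smul_comp c φ.1 f.1))

theorem permHom_eq_precomp (r : ℕ) (ρ : E →ₗ[K] E ⊗[K] A) (τ : W →ₗ[K] W ⊗[K] A)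
    (σ : Equiv.Perm (Fin r)) :
    permHom r ρ τ σ =
      precomp _ _ τ ⟨permTensor K E r σ⁻¹, mem_homG.2 (tensorCoact_perm r ρ σ⁻¹)⟩ := by
  ext φ : 2
  rfl

/-! ### Actions obtained by base change -/

/-- Let `x = ∑ aᵢ ⊗ gᵢ` be a point of `X` over `A` and `f : X → End(E)` a polynomial map.  The
coaction `θ` on `E` is given by the value of `f` at `x`. -/
def IsValueAt {X : Type*} [AddCommGroup X] [Module K X] {ι : Type} [Fintype ι] (a : ι → A)
    (g : ι → X) (f : X → E →ₗ[K] E) (θ : E →ₗ[K] E ⊗[K] A) : Prop :=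
  ∃ (J : Type) (_ : Fintype J) (m : J → ι → ℕ) (c : J → E →ₗ[K] E),
    (∀ t : ι → K, f (∑ i, t i • g i) = ∑ j, (∏ i, t i ^ m j i) • c j) ∧
    ∀ v, θ v = ∑ j, c j v ⊗ₜ[K] ∏ i, a i ^ m j i

/-- Each coordinate of the sum is a polynomial over K that vanishes on K^ι, hence is zero, hence
vanishes at the point a of A^ι. -/
theorem sum_tmul_eq_zero [Infinite K] {ι : Type} [Fintype ι] {J : Type} [Fintype J]
    (m : J → ι → ℕ) (y : J → E) (h : ∀ t : ι → K, ∑ j, (∏ i, t i ^ m j i) • y j = 0) (a : ι → A) :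
    ∑ j, y j ⊗ₜ[K] ∏ i, a i ^ m j i = 0 := by
  let b := Module.Free.chooseBasis K E
  refine (TensorProduct.equivFinsuppOfBasisLeft (N := A) b).injective ?_
  ext k
  rw [map_sum, map_zero, Finsupp.finsetSum_apply, Finsupp.zero_apply]
  simp only [TensorProduct.equivFinsuppOfBasisLeft_apply_tmul_apply]
  let q : MvPolynomial ι K := ∑ j, MvPolynomial.C (b.repr (y j) k) *
    ∏ i, MvPolynomial.X i ^ m j i
  have hq : q = 0 := by
    refine MvPolynomial.funext fun t => ?_
    have h1 := congrArg (b.coord k) (h t)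
    simp only [map_sum, map_smul, map_zero, smul_eq_mul] at h1
    simp only [q, map_sum, map_mul, map_prod, map_pow, MvPolynomial.eval_C, MvPolynomial.eval_X,
      map_zero]
    rw [← h1]
    exact Finset.sum_congr rfl fun j _ => mul_comm _ _
  have h2 := congrArg (MvPolynomial.aeval a) hq
  simp only [q, map_sum, map_mul, map_prod, map_pow, MvPolynomial.aeval_C, MvPolynomial.aeval_X,
    map_zero] at h2
  rw [← h2]
  exact Finset.sum_congr rfl fun j _ => Algebra.smul_def _ _

/-- Equivariance for G is deduced from commutation with all K-points x of X: both sides are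
polynomial in x, so the identity carries over to the A-point. -/
theorem mem_homG_of_isValueAt [Infinite K] {X : Type*} [AddCommGroup X] [Module K X] {ι : Type}
    [Fintype ι] {a : ι → A} {g : ι → X} {f : X → E →ₗ[K] E} {θ : E →ₗ[K] E ⊗[K] A}
    {f' : X → E' →ₗ[K] E'} {θ' : E' →ₗ[K] E' ⊗[K] A} (hθ : IsValueAt a g f θ)
    (hθ' : IsValueAt a g f' θ') (F : E →ₗ[K] E') (hF : ∀ x, f' x ∘ₗ F = F ∘ₗ f x) :
    F ∈ homG θ θ' := by
  obtain ⟨J, _, m, c, hc, hv⟩ := hθ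
  obtain ⟨J', _, m', c', hc', hv'⟩ := hθ'
  rw [mem_homG]
  ext v
  rw [LinearMap.comp_apply, LinearMap.comp_apply, hv, hv', map_sum, ← sub_eq_zero]
  have h := sum_tmul_eq_zero (Sum.elim m' m) (Sum.elim (fun j => c' j (F v)) fun j => -F (c j v))
    (fun t : ι → K => by
      have h1 := DFunLike.congr_fun (hF (∑ i, (t i : K) • g i)) v
      rw [LinearMap.comp_apply, LinearMap.comp_apply, hc, hc', ← sub_eq_zero] at h1
      rw [← h1]
      simp [Fintype.sum_sum_type, sub_eq_add_neg]) a
  rw [← h]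
  simp [Fintype.sum_sum_type, sub_eq_add_neg, TensorProduct.neg_tmul]

theorem IsValueAt.tensorCoact {X : Type*} [AddCommGroup X] [Module K X] {ι : Type} [Fintype ι]
    {a : ι → A} {g : ι → X} {f : X → E →ₗ[K] E} {θ : E →ₗ[K] E ⊗[K] A}
    (hθ : IsValueAt a g f θ) (r : ℕ) :
    IsValueAt a g (fun x => tensorMap r (f x)) (tensorCoact r θ) := by
  classical
  obtain ⟨J, _, m, c, hc, hv⟩ := hθ
  refine ⟨Fin r → J, inferInstance, fun α i => ∑ s, m (α s) i,
    fun α => PiTensorProduct.map fun s => c (α s), fun t => ?_, fun v => ?_⟩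
  · simp only [hc]
    change PiTensorProduct.mapMultilinear K _ _ (fun _ => ∑ j, (∏ i, t i ^ m j i) • c j) = _
    rw [MultilinearMap.map_sum]
    refine Finset.sum_congr rfl fun α _ => ?_
    rw [MultilinearMap.map_smul_univ, Finset.prod_comm]
    simp_rw [Finset.prod_pow_eq_pow_sum]
    rfl
  · let R : (⨂[K]^r E) →ₗ[K] (⨂[K]^r E) ⊗[K] A := ∑ α : Fin r → J,
      (TensorProduct.mk K (⨂[K]^r E) A).flip (∏ i, a i ^ ∑ s, m (α s) i) ∘ₗ
        PiTensorProduct.map fun s => c (α s)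
    suffices TensorInvariants.tensorCoact r θ = R by
      rw [this]
      simp [R]
    ext w
    simp only [LinearMap.compMultilinearMap_apply, TensorInvariants.tensorCoact,
      PiTensorProduct.lift.tprod, MultilinearMap.compLinearMap_apply, hv, R, LinearMap.sum_apply,
      LinearMap.comp_apply, PiTensorProduct.map_tprod, LinearMap.flip_apply,
      TensorProduct.mk_apply]
    rw [MultilinearMap.map_sum]
    refine Finset.sum_congr rfl fun α _ => ?_
    rw [mergeTensors_tmul r (fun s => c (α s) (w s)) fun s => ∏ i, a i ^ m (α s) i,
      Finset.prod_comm]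
    simp_rw [Finset.prod_pow_eq_pow_sum]

end

section

variable {K A W : Type u} [Field K] [CharZero K] [CommRing A] [Algebra K A] [AddCommGroup W]
  [Module K W] [Module.Finite K W] {V : Type u} [AddCommGroup V] [Module K V]
  [Module.Finite K V] {Q : FGModuleCat.{u} K ⥤ FGModuleCat.{u} K}

/-- The cyclicity argument of `sum_permCoeff_mul_trace`, carried out on Hom_G(T^d(V), W) and
Hom_G(Q(V), W), between which the in and out maps act by precomposition. -/
theorem sum_permCoeff_mul_trace_precomp (hQ : IsPolyFunctor Q) (s : Q ⟶ Q)
    (ρ : V →ₗ[K] V ⊗[K] A) (τ : W →ₗ[K] W ⊗[K] A)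
    (θ : Q.obj (FGModuleCat.of K V) →ₗ[K] Q.obj (FGModuleCat.of K V) ⊗[K] A)
    {ι : Type} [Fintype ι] {a : ι → A} {g : ι → V →ₗ[K] V}
    (hρ : IsValueAt a g (fun x => x) ρ) (hθ : IsValueAt a g (fun x => fmap Q x) θ) (d : ℕ) :
    ∃ (hmem : natApp s V ∘ₗ (polarMap hQ d fun _ => LinearMap.id) ∈ homG θ θ),
      ∑ π, permCoeff hQ s d π * LinearMap.trace K _ (precomp _ _ τ
        ⟨permTensor K V d π, mem_homG.2 (tensorCoact_perm d ρ π)⟩) =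
      LinearMap.trace K _ (precomp θ θ τ ⟨_, hmem⟩) := by
  let c := Module.finBasis K (Q.obj (FGModuleCat.of K (Fin d → K)))
  have hT := hρ.tensorCoact d
  have hin : ∀ x, inMap hQ d x ∈ homG (tensorCoact d ρ) θ := fun x =>
    mem_homG_of_isValueAt hT hθ _ fun g => fmap_comp_inMap hQ d x g
  have hout : ∀ ξ, outMap hQ d ξ ∈ homG θ (tensorCoact d ρ) := fun ξ =>
    mem_homG_of_isValueAt hθ hT _ fun g => (outMap_comp_fmap hQ d ξ g).symm
  have hs : natApp s V ∈ homG θ θ :=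
    mem_homG_of_isValueAt hθ hθ _ fun g => (natApp_comp_fmap s g).symm
  let I : Fin _ → homG (tensorCoact d ρ) θ := fun j => ⟨inMap hQ d (c j), hin _⟩
  let O : Fin _ → homG θ (tensorCoact d ρ) := fun j => ⟨outMap hQ d (c.coord j), hout _⟩
  let S : homG θ θ := ⟨natApp s V, hs⟩
  let Φ : Fin _ → homG θ θ := fun j => precomp θ _ θ (O j) (precomp _ θ θ (I j) S)
  let Ψ : Fin _ → homG (tensorCoact d ρ) (tensorCoact d ρ) := fun j =>
    precomp _ θ _ (I j) (precomp θ θ _ S (O j))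
  have h1 : (∑ j, Φ j).1 = natApp s V ∘ₗ (polarMap hQ d fun _ => LinearMap.id) := by
    rw [← sum_inMap_comp_outMap hQ d c, sum_comp_left, AddSubmonoidClass.coe_finsetSum]
    rfl
  have h2 : ∑ j, Ψ j = ∑ π, permCoeff hQ s d π •
      (⟨permTensor K V d π, mem_homG.2 (tensorCoact_perm d ρ π)⟩ :
        homG (tensorCoact d ρ) (tensorCoact d ρ)) := by
    refine Subtype.ext ?_
    rw [AddSubmonoidClass.coe_finsetSum, AddSubmonoidClass.coe_finsetSum]
    exact sum_outMap_comp_inMap hQ s d c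
  refine ⟨h1 ▸ (∑ j, Φ j).2, ?_⟩
  have h3 : (⟨_, h1 ▸ (∑ j, Φ j).2⟩ : homG θ θ) = ∑ j, Φ j := Subtype.ext h1.symm
  have h4 : ∀ j, LinearMap.trace K _ (precomp θ θ τ (Φ j)) =
      LinearMap.trace K _ (precomp _ _ τ (Ψ j)) := by
    intro j
    have e1 : precomp θ θ τ (Φ j) = precomp θ _ τ (O j) ∘ₗ precomp _ θ τ (I j) ∘ₗ
        precomp θ θ τ S := rfl
    have e2 : precomp _ _ τ (Ψ j) = (precomp _ θ τ (I j) ∘ₗ precomp θ θ τ S) ∘ₗ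
        precomp θ _ τ (O j) := rfl
    rw [e1, e2, LinearMap.trace_comp_comm']
  rw [h3, map_sum, map_sum]
  simp_rw [h4]
  rw [← map_sum, ← map_sum, h2, map_sum, map_sum]
  refine Finset.sum_congr rfl fun π _ => ?_
  rw [map_smul, map_smul, smul_eq_mul]

end

/-! ### Polynomial laws -/

section

variable {K : Type u} [Field K]

theorem exists_toFun'_eq {X Y : Type u} [AddCommGroup X] [Module K X] [AddCommGroup Y] [Module K Y]
    (φ : X →ₚₗ[K] Y) {n : ℕ} (g : Fin n → X) :
    ∃ (J : Type) (_ : Fintype J) (m : J → Fin n → ℕ) (c : J → Y),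
      ∀ (A : Type u) [CommRing A] [Algebra K A] (a : Fin n → A),
        φ.toFun' A (∑ i, a i ⊗ₜ[K] g i) = ∑ j, (∏ i, a i ^ m j i) ⊗ₜ[K] c j := by
  let e := TensorProduct.equivFinsuppOfBasisLeft (N := Y) (MvPolynomial.basisMonomials (Fin n) K)
  -- The value at the universal combination of the g_i; compatibility with X_i ↦ a_i gives all other
  -- values, so m and c do not depend on A.
  let z := φ.toFun' (MvPolynomial (Fin n) K) (∑ i, MvPolynomial.X i ⊗ₜ[K] g i)
  refine ⟨(e z).support, inferInstance, fun j => j.1, fun j => e z j.1, fun A _ _ a => ?_⟩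
  have h := φ.isCompat_apply' (MvPolynomial.aeval a : MvPolynomial (Fin n) K →ₐ[K] A)
    (∑ i, MvPolynomial.X i ⊗ₜ[K] g i)
  have hz : z = ∑ j : (e z).support, MvPolynomial.monomial j.1 1 ⊗ₜ[K] e z j.1 := by
    conv_lhs => rw [← e.symm_apply_apply z]
    rw [TensorProduct.equivFinsuppOfBasisLeft_symm_apply, Finsupp.sum, ← Finset.sum_coe_sort]
    simp
  simp only [map_sum, LinearMap.rTensor_tmul, AlgHom.toLinearMap_apply, MvPolynomial.aeval_X] at h
  rw [← h]
  change LinearMap.rTensor _ _ z = _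
  generalize e z = w at hz ⊢
  rw [hz]
  simp [MvPolynomial.aeval_monomial, Finsupp.prod_fintype]

theorem exists_ground_eq {X Y : Type u} [AddCommGroup X] [Module K X] [AddCommGroup Y] [Module K Y]
    (φ : X →ₚₗ[K] Y) {n : ℕ} (g : Fin n → X) :
    ∃ (J : Type) (_ : Fintype J) (m : J → Fin n → ℕ) (c : J → Y),
      (∀ t : Fin n → K, φ.ground (∑ i, t i • g i) = ∑ j, (∏ i, t i ^ m j i) • c j) ∧
      ∀ (A : Type u) [CommRing A] [Algebra K A] (a : Fin n → A),
        φ.toFun' A (∑ i, a i ⊗ₜ[K] g i) = ∑ j, (∏ i, a i ^ m j i) ⊗ₜ[K] c j := by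
  obtain ⟨J, hJ, m, c, h⟩ := exists_toFun'_eq φ g
  refine ⟨J, hJ, m, c, fun t => ?_, h⟩
  rw [PolynomialLaw.ground_apply, TensorProduct.tmul_sum]
  simp_rw [TensorProduct.tmul_smul, TensorProduct.smul_tmul', smul_eq_mul, mul_one]
  rw [h, map_sum]
  simp

theorem IsPolyMap.of_ground {X Y : Type u} [AddCommGroup X] [Module K X] [Module.Finite K X]
    [AddCommGroup Y] [Module K Y] (φ : X →ₚₗ[K] Y) : IsPolyMap (K := K) φ.ground := by
  let b := Module.finBasis K X
  obtain ⟨J, hJ, m, c, h, -⟩ := exists_ground_eq φ b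
  refine ⟨_, b.coord, J, hJ, m, c, fun x => ?_⟩
  conv_lhs => rw [← b.sum_repr x]
  exact h _

/-! ### Tensor powers of functors -/

theorem IsPolyMap.tensorMap {X E E' : Type u} [AddCommGroup X] [Module K X] [AddCommGroup E]
    [Module K E] [AddCommGroup E'] [Module K E'] {f : X → E →ₗ[K] E'} (hf : IsPolyMap (K := K) f)
    (r : ℕ) : IsPolyMap (K := K) fun x => tensorMap r (f x) := by
  classical
  obtain ⟨n, l, J, _, m, c, hf⟩ := hf
  refine ⟨n, l, Fin r → J, inferInstance, fun α i => ∑ s, m (α s) i,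
    fun α => PiTensorProduct.map fun s => c (α s), fun x => ?_⟩
  simp only [hf]
  change PiTensorProduct.mapMultilinear K _ _ (fun _ => ∑ j, (∏ i, l i x ^ m j i) • c j) = _
  rw [MultilinearMap.map_sum]
  refine Finset.sum_congr rfl fun α _ => ?_
  rw [MultilinearMap.map_smul_univ, Finset.prod_comm]
  simp_rw [Finset.prod_pow_eq_pow_sum]
  rfl

/-- The functor `U ↦ T^r(P(U))`. -/
def tensorFunctor (r : ℕ) (P : FGModuleCat.{u} K ⥤ FGModuleCat.{u} K) :
    FGModuleCat.{u} K ⥤ FGModuleCat.{u} K where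
  obj U := FGModuleCat.of K (⨂[K]^r (P.obj U))
  map f := FGModuleCat.ofHom (tensorMap r (P.map f).hom.hom)
  map_id U := by
    rw [CategoryTheory.Functor.map_id]
    exact congrArg FGModuleCat.ofHom PiTensorProduct.map_id
  map_comp f g := by
    rw [CategoryTheory.Functor.map_comp]
    exact congrArg FGModuleCat.ofHom (PiTensorProduct.map_comp _ _)

/-- The permutations of the factors of `T^r(P(U))`. -/
def permNat (r : ℕ) (P : FGModuleCat.{u} K ⥤ FGModuleCat.{u} K) (σ : Equiv.Perm (Fin r)) :
    tensorFunctor r P ⟶ tensorFunctor r P where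
  app U := FGModuleCat.ofHom (permTensor K (P.obj U) r σ)
  naturality U U' f := by
    suffices permTensor K (P.obj U') r σ ∘ₗ TensorInvariants.tensorMap r (P.map f).hom.hom =
        TensorInvariants.tensorMap r (P.map f).hom.hom ∘ₗ permTensor K (P.obj U) r σ from
      congrArg FGModuleCat.ofHom this
    ext v
    simp only [LinearMap.compMultilinearMap_apply, LinearMap.comp_apply,
      TensorInvariants.tensorMap, PiTensorProduct.map_tprod, permTensor_tprod]

variable {P : FGModuleCat.{u} K ⥤ FGModuleCat.{u} K}

theorem isPolyMap_fmap (hP : IsPolynomialFunctor P) (U V : Type u) [AddCommGroup U] [Module K U]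
    [Module.Finite K U] [AddCommGroup V] [Module K V] [Module.Finite K V] :
    IsPolyMap (K := K) fun f : U →ₗ[K] V => fmap P f := by
  obtain ⟨φ, hφ⟩ := hP (FGModuleCat.of K U) (FGModuleCat.of K V)
  have h : (fun f : U →ₗ[K] V => fmap P f) = φ.ground :=
    funext fun f => (hφ (FGModuleCat.ofHom f)).symm
  rw [h]
  exact IsPolyMap.of_ground (X := U →ₗ[K] V) φ

theorem isPolyFunctor_of (hP : IsPolynomialFunctor P) : IsPolyFunctor P :=
  fun U V => (isPolyMap_fmap hP U V).isSumOfHomogeneous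

theorem isPolyFunctor_tensorFunctor (hP : IsPolynomialFunctor P) (r : ℕ) :
    IsPolyFunctor (tensorFunctor r P) :=
  fun U V => ((isPolyMap_fmap hP U V).tensorMap r).isSumOfHomogeneous

/-- A coaction on `V` is the value of the identity at a point of `End(V)`, and the coaction on
`P(V)` is the value of `P` at the same point. -/
theorem exists_isValueAt {A V : Type u} [CommRing A] [Algebra K A] [AddCommGroup V] [Module K V]
    [Module.Finite K V] (hP : IsPolynomialFunctor P) (ρ : V →ₗ[K] V ⊗[K] A) :
    ∃ (n : ℕ) (a : Fin n → A) (g : Fin n → V →ₗ[K] V), IsValueAt a g (fun x => x) ρ ∧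
      IsValueAt a g (fun x => fmap P x) (functorCoact hP ρ) := by
  classical
  obtain ⟨n, g, a, hga⟩ : ∃ (n : ℕ) (g : Fin n → V →ₗ[K] V) (a : Fin n → A),
      (rTensorHomEquivHomRTensor K V V A).symm ρ = ∑ i, g i ⊗ₜ[K] a i := by
    let e := TensorProduct.equivFinsuppOfBasisLeft (N := A) (Module.finBasis K (V →ₗ[K] V))
    refine ⟨_, Module.finBasis K (V →ₗ[K] V),
      fun i => e ((rTensorHomEquivHomRTensor K V V A).symm ρ) i, ?_⟩
    conv_lhs => rw [← e.symm_apply_apply ((rTensorHomEquivHomRTensor K V V A).symm ρ)]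
    rw [TensorProduct.equivFinsuppOfBasisLeft_symm_apply, Finsupp.sum_fintype _ _ (by simp)]
  have hρ : ρ = ∑ i, rTensorHomEquivHomRTensor K V V A (g i ⊗ₜ[K] a i) := by
    rw [← map_sum, ← hga, LinearEquiv.apply_symm_apply]
  refine ⟨n, a, g, ⟨Fin n, inferInstance, fun j i => if i = j then 1 else 0, g, fun t => ?_,
    fun v => ?_⟩, ?_⟩
  · refine Finset.sum_congr rfl fun j _ => ?_
    simp [pow_ite]
  · conv_lhs => rw [hρ]
    rw [LinearMap.sum_apply]
    refine Finset.sum_congr rfl fun j _ => ?_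
    simp [pow_ite]
  · obtain ⟨J, hJ, m, c, h1, h2⟩ := exists_ground_eq (X := V →ₗ[K] V)
      (hP (FGModuleCat.of K V) (FGModuleCat.of K V)).choose g
    refine ⟨J, hJ, m, c, fun t => ?_, fun v => ?_⟩
    · rw [← h1]
      exact ((hP (FGModuleCat.of K V) (FGModuleCat.of K V)).choose_spec
        (FGModuleCat.ofHom (∑ i, t i • g i))).symm
    · have h3 := h2 A a
      have h4 : functorCoact hP ρ = rTensorHomEquivHomRTensor K _ _ A
          (TensorProduct.comm K A _
            ((hP (FGModuleCat.of K V) (FGModuleCat.of K V)).choose.toFun' A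
              (∑ i, a i ⊗ₜ[K] g i))) := by
        rw [functorCoact, hga, map_sum]
        rfl
      rw [h4]
      refine (congrArg (fun z => rTensorHomEquivHomRTensor K _ _ A
          (TensorProduct.comm K A _ z) v) h3).trans ?_
      simp

end

/-! ### Symmetric functions given by functions on the symmetric groups -/

section

variable {K : Type u} [Field K]

/-- The symmetric function `∑ d, (1/d!) ∑ π, w_d(π) p_{λ(π)}`. -/
def permSeries (w : ∀ d, Equiv.Perm (Fin d) → K) : SymFun K :=
  gradedSum fun d => ((d.factorial : ℕ) : K)⁻¹ • ∑ π, w d π • pProd π.partition.parts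

theorem homChar_eq {A V W : Type u} [CommRing A] [Algebra K A] [AddCommGroup V] [Module K V]
    [AddCommGroup W] [Module K W] (ρ : V →ₗ[K] V ⊗[K] A) (τ : W →ₗ[K] W ⊗[K] A) :
    homChar ρ τ = permSeries fun r σ => LinearMap.trace K _ (permHom r ρ τ σ) := rfl

theorem coeff_permSeries (w : ∀ d, Equiv.Perm (Fin d) → K) {d : ℕ} (l : d.Partition) :
    MvPowerSeries.coeff (expOf l.parts) (permSeries w) = ((d.factorial : ℕ) : K)⁻¹ *
      ∑ π : Equiv.Perm (Fin d) with π.partition.parts = l.parts, w d π := by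
  classical
  have h : MvPowerSeries.coeff (expOf l.parts) (permSeries w) =
      MvPowerSeries.coeff (expOf l.parts)
        (((d.factorial : ℕ) : K)⁻¹ • ∑ π, w d π • pProd π.partition.parts) := by
    change MvPowerSeries.coeff (expOf l.parts) ((fun d => ((d.factorial : ℕ) : K)⁻¹ •
      ∑ π, w d π • (pProd π.partition.parts : SymFun K)) (size (expOf l.parts))) = _
    dsimp only
    rw [size_expOf_partition]
  rw [h, map_smul, map_sum, smul_eq_mul, Finset.sum_filter]
  congr 1
  refine Finset.sum_congr rfl fun π _ => ?_
  rw [map_smul, pProd, MvPowerSeries.coeff_monomial, smul_eq_mul, mul_ite, mul_one, mul_zero]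
  exact if_congr ⟨fun h => (expOf_injective h).symm, fun h => by rw [h]⟩ rfl rfl

theorem sum_partition_sum_perm {d : ℕ} (w : Equiv.Perm (Fin d) → K) :
    ∑ l : d.Partition, ∑ π : Equiv.Perm (Fin d) with π.partition.parts = l.parts, w π =
      ∑ π, w π := by
  let t : Equiv.Perm (Fin d) → d.Partition := fun π =>
    ⟨π.partition.parts, fun h => π.partition.parts_pos h,
      π.partition.parts_sum.trans (Fintype.card_fin d)⟩
  rw [← Finset.sum_fiberwise_of_maps_to (g := t) fun π _ => Finset.mem_univ (t π)]
  refine Finset.sum_congr rfl fun l _ => Finset.sum_congr (Finset.filter_congr fun π _ => ?_)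
    fun _ _ => rfl
  exact ⟨fun h => Nat.Partition.ext h, fun h => congrArg Nat.Partition.parts h⟩

theorem evalPart_permSeries (w : ∀ d, Equiv.Perm (Fin d) → K) {n : ℕ} (a : Fin n → K) (d : ℕ) :
    evalPart (permSeries w) a d = ((d.factorial : ℕ) : K)⁻¹ *
      ∑ π, w d π * (π.partition.parts.map fun k => ∑ i, a i ^ k).prod := by
  rw [evalPart, ← sum_partition_sum_perm, Finset.mul_sum]
  refine Finset.sum_congr rfl fun l _ => ?_
  rw [coeff_permSeries, mul_assoc, Finset.sum_mul]
  congr 1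
  refine Finset.sum_congr rfl fun π hπ => ?_
  rw [(Finset.mem_filter.1 hπ).2]

/-- Hall's form becomes the averaged product over the symmetric group. It suffices that w is a class
function, since z_λ times its coefficient is then its value on the class, while v is only summed
over the class. -/
theorem sum_zee_mul_coeff [CharZero K] (v w : ∀ d, Equiv.Perm (Fin d) → K) (d : ℕ)
    (hw : ∀ π π' : Equiv.Perm (Fin d), π.partition.parts = π'.partition.parts → w d π = w d π') :
    ∑ l : d.Partition, ((zee (expOf l.parts) : ℕ) : K) *
      MvPowerSeries.coeff (expOf l.parts) (permSeries v) *
      MvPowerSeries.coeff (expOf l.parts) (permSeries w) =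
      ((d.factorial : ℕ) : K)⁻¹ * ∑ π, v d π * w d π := by
  rw [← sum_partition_sum_perm, Finset.mul_sum]
  refine Finset.sum_congr rfl fun l _ => ?_
  have hd : ((d.factorial : ℕ) : K) ≠ 0 := Nat.cast_ne_zero.2 d.factorial_ne_zero
  have h : ∀ π ∈ Finset.univ.filter fun π : Equiv.Perm (Fin d) => π.partition.parts = l.parts,
      w d π = ((zee (expOf l.parts) : ℕ) : K) *
        MvPowerSeries.coeff (expOf l.parts) (permSeries w) := by
    intro π hπ
    rw [coeff_permSeries, Finset.sum_congr rfl fun π' hπ' => hw π' π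
      ((Finset.mem_filter.1 hπ').2.trans (Finset.mem_filter.1 hπ).2.symm), Finset.sum_const,
      nsmul_eq_mul, mul_left_comm, ← mul_assoc (_ : K) _ (w d π), ← Nat.cast_mul, zee_mul_card,
      inv_mul_cancel_left₀ hd]
  rw [Finset.sum_congr rfl fun π hπ => by rw [h π hπ], ← Finset.sum_mul, coeff_permSeries v]
  ring

end

/-! ### Characters -/

section

variable {K : Type u} [Field K] {Q : FGModuleCat.{u} K ⥤ FGModuleCat.{u} K}

theorem trace_toLin'_diagonal_pow {n : ℕ} (a : Fin n → K) (k : ℕ) :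
    LinearMap.trace K (Fin n → K) (Matrix.toLin' (Matrix.diagonal a) ^ k) = ∑ i, a i ^ k := by
  rw [← Matrix.toLin'_pow, Matrix.diagonal_pow, Matrix.trace_toLin'_eq, Matrix.trace_diagonal]
  rfl

theorem isCharacter_iff {P : FGModuleCat.{u} K ⥤ FGModuleCat.{u} K} {f : SymFun K} :
    IsCharacter P f ↔ ∀ (n : ℕ) (a : Fin n → K), (∀ i, a i ≠ 0) →
      HasValue f a (LinearMap.trace K _ (fmap P (Matrix.toLin' (Matrix.diagonal a)))) := by
  simp_rw [hasValue_iff]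
  rfl

theorem fmap_pow (P : FGModuleCat.{u} K ⥤ FGModuleCat.{u} K) {V : Type u} [AddCommGroup V]
    [Module K V] [Module.Finite K V] (h : V →ₗ[K] V) (k : ℕ) :
    fmap P (h ^ k) = fmap P h ^ k := by
  induction k with
  | zero => exact fmap_id
  | succ k ih =>
    rw [pow_succ, pow_succ, ← ih]
    exact fmap_comp _ _

variable [CharZero K]

/-- The character of a polynomial functor with a natural endomorphism. -/
theorem hasValue_permSeries (hQ : IsPolyFunctor Q) (s : Q ⟶ Q) {n : ℕ} (a : Fin n → K) :
    HasValue (permSeries (permCoeff hQ s)) a (LinearMap.trace K _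
      (natApp s (Fin n → K) ∘ₗ fmap Q (Matrix.toLin' (Matrix.diagonal a)))) := by
  have h : ∀ d, evalPart (permSeries (permCoeff hQ s)) a d = ((d.factorial : ℕ) : K)⁻¹ *
      LinearMap.trace K _ ((polarMap hQ d fun _ => LinearMap.id) ∘ₗ natApp s (Fin n → K) ∘ₗ
        fmap Q (Matrix.toLin' (Matrix.diagonal a))) := by
    intro d
    rw [evalPart_permSeries, ← sum_permCoeff_mul_trace]
    simp_rw [trace_permTensor_comp_tensorMap, trace_toLin'_diagonal_pow]
  have hsupp : Function.support (evalPart (permSeries (permCoeff hQ s)) a) ⊆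
      Finset.range (degreeBound (hQ (Fin n → K) (Fin n → K))) := by
    intro d hd
    by_contra hd'
    refine hd ?_
    rw [h, polarMap, polar_eq_zero _ (by simpa using hd')]
    simp
  rw [hasValue_iff]
  refine ⟨(Finset.finite_toSet _).subset hsupp, ?_⟩
  rw [finsum_eq_sum_of_support_subset _ hsupp]
  -- The identity of Q(K^n) is Q(id), the sum of the polarizations at id divided by d!; summing over
  -- d therefore removes the polarization from the trace.
  have h1 : (LinearMap.id : Q.obj (FGModuleCat.of K (Fin n → K)) →ₗ[K] _) = _ :=
    fmap_id.symm.trans (eq_sum_polar (hQ (Fin n → K) (Fin n → K)) LinearMap.id)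
  conv_rhs => rw [← LinearMap.id_comp (natApp s (Fin n → K) ∘ₗ _), h1, sum_comp_right, map_sum]
  refine Finset.sum_congr rfl fun d _ => ?_
  rw [h, LinearMap.smul_comp, map_smul, smul_eq_mul]
  rfl

theorem existsUnique_isCharacter {P : FGModuleCat.{u} K ⥤ FGModuleCat.{u} K}
    (hP : IsPolynomialFunctor P) : ∃! f : SymFun K, IsCharacter P f := by
  refine ⟨permSeries (permCoeff (isPolyFunctor_of hP) (𝟙 P)), ?_, fun g hg => ?_⟩
  · exact isCharacter_iff.2 fun n a _ => hasValue_permSeries (isPolyFunctor_of hP) (𝟙 P) a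
  · exact eq_of_hasValue _ (isCharacter_iff.1 hg)
      fun n a _ => hasValue_permSeries (isPolyFunctor_of hP) (𝟙 P) a

theorem isCharacter_functorChar {P : FGModuleCat.{u} K ⥤ FGModuleCat.{u} K}
    (hP : IsPolynomialFunctor P) : IsCharacter P (functorChar P) :=
  Classical.epsilon_spec (existsUnique_isCharacter hP).exists

/-- The character of `T^r ∘ P` twisted by a permutation of the factors. -/
theorem prod_adams_functorChar {P : FGModuleCat.{u} K ⥤ FGModuleCat.{u} K}
    (hP : IsPolynomialFunctor P) (r : ℕ) (σ : Equiv.Perm (Fin r)) :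
    ((expOf σ.partition.parts).prod fun k e => adams k (functorChar P) ^ e) =
      permSeries (permCoeff (isPolyFunctor_tensorFunctor hP r) (permNat r P σ)) := by
  refine eq_of_hasValue (fun n a => LinearMap.trace K _ (natApp (permNat r P σ) (Fin n → K) ∘ₗ
    fmap (tensorFunctor r P) (Matrix.toLin' (Matrix.diagonal a)))) (fun n a ha => ?_)
    fun n a _ => hasValue_permSeries _ _ a
  have h : LinearMap.trace K _ (natApp (permNat r P σ) (Fin n → K) ∘ₗ
      fmap (tensorFunctor r P) (Matrix.toLin' (Matrix.diagonal a))) =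
      (σ.partition.parts.map fun k => LinearMap.trace K _
        (fmap P (Matrix.toLin' (Matrix.diagonal a)) ^ k)).prod :=
    trace_permTensor_comp_tensorMap r σ (fmap P (Matrix.toLin' (Matrix.diagonal a)))
  rw [h, ← expOf_prod _ _ fun k hk => σ.partition.parts_pos hk]
  refine HasValue.prod _ fun k _ => HasValue.pow (HasValue.adams ?_) _
  -- p_k[ch P] at a is ch P at the powers a_i^k, that is Tr P(D^k) = Tr P(D)^k.
  have h2 := isCharacter_iff.1 (isCharacter_functorChar hP) n (fun i => a i ^ (k : ℕ))
    fun i => pow_ne_zero _ (ha i)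
  rwa [← fmap_pow, ← Matrix.toLin'_pow, Matrix.diagonal_pow]

end

/-! ### The graded Frobenius characters -/

theorem exists_perm_parts_eq {r : ℕ} (l : r.Partition) :
    ∃ σ : Equiv.Perm (Fin r), σ.partition.parts = l.parts := by
  by_contra! h
  have := zee_mul_card l
  rw [Finset.filter_eq_empty_iff.2 fun σ _ => h σ, Finset.card_empty, mul_zero] at this
  exact r.factorial_ne_zero this.symm

theorem exists_partition_expOf_eq (m : ℕ+ →₀ ℕ) : ∃ l : (size m).Partition, expOf l.parts = m :=
  ⟨⟨partsOf m, partsOf_pos m, partsOf_sum m⟩, expOf_partsOf m⟩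

theorem parts_inv {d : ℕ} (π : Equiv.Perm (Fin d)) :
    π⁻¹.partition.parts = π.partition.parts := by
  rw [Equiv.Perm.parts_partition, Equiv.Perm.parts_partition, Equiv.Perm.cycleType_inv,
    Equiv.Perm.support_inv]

section

variable {K A V W : Type u} [Field K] [CommRing A] [Algebra K A] [AddCommGroup V] [Module K V]
  [AddCommGroup W] [Module K W]

theorem trace_permHom_eq_of_parts_eq (r : ℕ) (ρ : V →ₗ[K] V ⊗[K] A) (τ : W →ₗ[K] W ⊗[K] A)
    (π π' : Equiv.Perm (Fin r)) (h : π.partition.parts = π'.partition.parts) :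
    LinearMap.trace K _ (permHom r ρ τ π) = LinearMap.trace K _ (permHom r ρ τ π') := by
  obtain ⟨c, hc⟩ := isConj_iff.1 (Equiv.Perm.partition_eq_of_isConj.2 (Nat.Partition.ext h))
  rw [← hc, map_mul, LinearMap.trace_mul_comm,
    map_mul (permHom r ρ τ), ← mul_assoc, ← map_mul, inv_mul_cancel, map_one, one_mul]

variable {P : FGModuleCat.{u} K ⥤ FGModuleCat.{u} K}

variable [CharZero K] [Module.Finite K V] [Module.Finite K W]

/-- v d is the contribution of the degree d component of Q to the trace of s on Hom_G(Q(V), W); it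
vanishes from the degree bound of Q on End(V) on. -/
theorem exists_eq_sum_permCoeff {Q : FGModuleCat.{u} K ⥤ FGModuleCat.{u} K}
    (hQ : IsPolyFunctor Q) (s : Q ⟶ Q) (ρ : V →ₗ[K] V ⊗[K] A) (τ : W →ₗ[K] W ⊗[K] A)
    (θ : Q.obj (FGModuleCat.of K V) →ₗ[K] Q.obj (FGModuleCat.of K V) ⊗[K] A)
    {ι : Type} [Fintype ι] {a : ι → A} {g : ι → V →ₗ[K] V}
    (hρ : IsValueAt a g (fun x => x) ρ) (hθ : IsValueAt a g (fun x => fmap Q x) θ)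
    (hs : natApp s V ∈ homG θ θ) :
    ∃ (D : ℕ) (v : ℕ → K), (∀ d, D ≤ d → v d = 0) ∧
      ∑ d ∈ Finset.range D, v d = LinearMap.trace K _ (precomp θ θ τ ⟨natApp s V, hs⟩) ∧
      ∀ d, ((d.factorial : ℕ) : K)⁻¹ * ∑ π, permCoeff hQ s d π * LinearMap.trace K _
        (precomp _ _ τ ⟨permTensor K V d π, mem_homG.2 (tensorCoact_perm d ρ π)⟩) = v d := by
  choose hmem htr using fun d => sum_permCoeff_mul_trace_precomp hQ s ρ τ θ hρ hθ d
  refine ⟨degreeBound (hQ V V), fun d => ((d.factorial : ℕ) : K)⁻¹ *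
    LinearMap.trace K _ (precomp _ _ τ ⟨_, hmem d⟩), fun d hd => ?_, ?_, fun d => by rw [htr]⟩
  · have h0 : (⟨_, hmem d⟩ : homG θ θ) = 0 := by
      refine Subtype.ext ?_
      change natApp s V ∘ₗ polarMap hQ d (fun _ => LinearMap.id) = 0
      rw [polarMap, polar_eq_zero _ hd]
      exact LinearMap.comp_zero _
    dsimp only
    rw [h0, map_zero, map_zero, mul_zero]
  · have h1 : (⟨natApp s V, hs⟩ : homG θ θ) =
        ∑ d ∈ Finset.range (degreeBound (hQ V V)), ((d.factorial : ℕ) : K)⁻¹ • ⟨_, hmem d⟩ := by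
      refine Subtype.ext ?_
      rw [AddSubmonoidClass.coe_finsetSum]
      have h2 := fmap_id.symm.trans (eq_sum_polar (hQ V V) LinearMap.id)
      refine (LinearMap.comp_id (natApp s V)).symm.trans ?_
      rw [h2, sum_comp_left]
      refine Finset.sum_congr rfl fun d _ => ?_
      rw [LinearMap.comp_smul]
      rfl
    rw [h1, map_sum, map_sum]
    refine Finset.sum_congr rfl fun d _ => ?_
    rw [map_smul, map_smul, smul_eq_mul]

theorem exists_hallYPart_eq (hP : IsPolynomialFunctor P) (ρ : V →ₗ[K] V ⊗[K] A)
    (τ : W →ₗ[K] W ⊗[K] A) {r : ℕ} (σ : Equiv.Perm (Fin r)) :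
    ∃ (D : ℕ) (v : ℕ → K), (∀ d, D ≤ d → v d = 0) ∧
      ∑ d ∈ Finset.range D, v d = LinearMap.trace K _ (permHom r (functorCoact hP ρ) τ σ) ∧
      ∀ d, hallYPart (pleth bigH (alphX * inY (functorChar P))) (homChar ρ τ)
        (expOf σ.partition.parts) d = ((zee (expOf σ.partition.parts) : ℕ) : K)⁻¹ * v d := by
  obtain ⟨n, a, g, hρ, hθ⟩ := exists_isValueAt hP ρ
  have hQ := isPolyFunctor_tensorFunctor hP r
  -- `permHom` acts by precomposition with the inverse, hence σ⁻¹; its cycle type is that of σ.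
  obtain ⟨D, v, hv, hsum, h⟩ := exists_eq_sum_permCoeff hQ (permNat r P σ⁻¹) ρ τ
    (tensorCoact r (functorCoact hP ρ)) hρ (hθ.tensorCoact r)
    (mem_homG.2 (tensorCoact_perm r (functorCoact hP ρ) σ⁻¹))
  refine ⟨D, v, hv, hsum.trans ?_, fun d => ?_⟩
  · rw [permHom_eq_precomp]
    rfl
  · have hcoeff := prod_adams_functorChar hP r σ⁻¹
    rw [parts_inv] at hcoeff
    rw [hallYPart, homChar_eq]
    simp_rw [coeff_pleth, hcoeff]
    have h1 := sum_zee_mul_coeff (permCoeff hQ (permNat r P σ⁻¹))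
      (fun r σ => LinearMap.trace K _ (permHom r ρ τ σ)) d (trace_permHom_eq_of_parts_eq d ρ τ)
    have h2 : ∀ π, LinearMap.trace K _ (permHom d ρ τ π) = LinearMap.trace K _
        (precomp _ _ τ ⟨permTensor K V d π, mem_homG.2 (tensorCoact_perm d ρ π)⟩) := by
      intro π
      rw [trace_permHom_eq_of_parts_eq d ρ τ π π⁻¹ (parts_inv π).symm, permHom_eq_precomp]
      simp only [inv_inv]
    simp_rw [h2] at h1
    rw [← h d, ← h1, Finset.mul_sum]
    refine Finset.sum_congr rfl fun l _ => ?_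
    ring

theorem support_hallYPart_finite (hP : IsPolynomialFunctor P) (ρ : V →ₗ[K] V ⊗[K] A)
    (τ : W →ₗ[K] W ⊗[K] A) {r : ℕ} (σ : Equiv.Perm (Fin r)) :
    (Function.support (hallYPart (pleth bigH (alphX * inY (functorChar P))) (homChar ρ τ)
      (expOf σ.partition.parts))).Finite := by
  obtain ⟨D, v, hv, -, h⟩ := exists_hallYPart_eq hP ρ τ σ
  refine (Finset.finite_toSet (Finset.range D)).subset fun d hd => ?_
  by_contra hd'
  exact hd (by rw [h, hv d (by simpa using hd'), mul_zero])

theorem hallY_apply (hP : IsPolynomialFunctor P) (ρ : V →ₗ[K] V ⊗[K] A) (τ : W →ₗ[K] W ⊗[K] A)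
    {r : ℕ} (σ : Equiv.Perm (Fin r)) :
    hallY (pleth bigH (alphX * inY (functorChar P))) (homChar ρ τ) (expOf σ.partition.parts) =
      ((zee (expOf σ.partition.parts) : ℕ) : K)⁻¹ *
        LinearMap.trace K _ (permHom r (functorCoact hP ρ) τ σ) := by
  obtain ⟨D, v, hv, hsum, h⟩ := exists_hallYPart_eq hP ρ τ σ
  rw [hallY, ← hsum, Finset.mul_sum, finsum_eq_sum_of_support_subset (s := Finset.range D)]
  · exact Finset.sum_congr rfl fun d _ => h d
  · intro d hd
    by_contra hd'
    exact hd (by rw [h, hv d (by simpa using hd'), mul_zero])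

theorem hallYDefined_homChar (hP : IsPolynomialFunctor P) (ρ : V →ₗ[K] V ⊗[K] A)
    (τ : W →ₗ[K] W ⊗[K] A) :
    HallYDefined (pleth bigH (alphX * inY (functorChar P))) (homChar ρ τ) := by
  intro m
  obtain ⟨l, hl⟩ := exists_partition_expOf_eq m
  obtain ⟨σ, hσ⟩ := exists_perm_parts_eq l
  rw [← hl, ← hσ]
  exact support_hallYPart_finite hP ρ τ σ

theorem homChar_functorCoact (hP : IsPolynomialFunctor P) (ρ : V →ₗ[K] V ⊗[K] A)
    (τ : W →ₗ[K] W ⊗[K] A) :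
    homChar (functorCoact hP ρ) τ =
      hallY (pleth bigH (alphX * inY (functorChar P))) (homChar ρ τ) := by
  ext m
  obtain ⟨r, l, rfl⟩ : ∃ (r : ℕ) (l : r.Partition), expOf l.parts = m :=
    ⟨_, exists_partition_expOf_eq m⟩
  have hz : ((zee (expOf l.parts) : ℕ) : K) ≠ 0 := fun h => by
    have h2 := zee_mul_card l
    rw [Nat.cast_eq_zero.1 h, zero_mul] at h2
    exact r.factorial_ne_zero h2.symm
  have hr : ((r.factorial : ℕ) : K) ≠ 0 := Nat.cast_ne_zero.2 r.factorial_ne_zero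
  set H : K := hallY (pleth bigH (alphX * inY (functorChar P))) (homChar ρ τ) (expOf l.parts)
    with hH
  -- All r!/z_λ permutations of cycle type λ have the same trace z_λ H, so their sum divided by r!
  -- is H.
  have h : ∀ σ ∈ Finset.univ.filter fun σ : Equiv.Perm (Fin r) => σ.partition.parts = l.parts,
      LinearMap.trace K _ (permHom r (functorCoact hP ρ) τ σ) =
        ((zee (expOf l.parts) : ℕ) : K) * H := by
    intro σ hσ
    have h1 := hallY_apply hP ρ τ σ
    rw [(Finset.mem_filter.1 hσ).2] at h1
    rw [hH, h1, mul_inv_cancel_left₀ hz]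
  rw [homChar_eq, coeff_permSeries, Finset.sum_congr rfl h, Finset.sum_const, nsmul_eq_mul,
    ← mul_assoc (_ : K) _ H, ← Nat.cast_mul, mul_comm _ (zee _), zee_mul_card,
    inv_mul_cancel_left₀ hr]
  rfl

end

end

end TensorInvariants

theorem mainTheorem1 {K : Type u} [Field K] [CharZero K]
    {A : Type u} [CommRing A] [HopfAlgebra K A]
    {V W : Type u} [AddCommGroup V] [Module K V] [Module.Finite K V]
    [AddCommGroup W] [Module K W] [Module.Finite K W]
    (ρ : TensorInvariants.RationalRep K A V) (τ : TensorInvariants.RationalRep K A W)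
    (P : FGModuleCat.{u} K ⥤ FGModuleCat.{u} K) (hP : TensorInvariants.IsPolynomialFunctor P) :
    (∃! f : TensorInvariants.SymFun K, TensorInvariants.IsCharacter P f) ∧
    TensorInvariants.HallYDefined
      (TensorInvariants.pleth TensorInvariants.bigH
        (TensorInvariants.alphX * TensorInvariants.inY (TensorInvariants.functorChar P)))
      (TensorInvariants.homChar ρ.coact τ.coact) ∧
    TensorInvariants.homChar (TensorInvariants.functorCoact hP ρ.coact) τ.coact =
      TensorInvariants.hallY
        (TensorInvariants.pleth TensorInvariants.bigH
          (TensorInvariants.alphX * TensorInvariants.inY (TensorInvariants.functorChar P)))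
        (TensorInvariants.homChar ρ.coact τ.coact) :=
  ⟨TensorInvariants.existsUnique_isCharacter hP,
    TensorInvariants.hallYDefined_homChar hP ρ.coact τ.coact,
    TensorInvariants.homChar_functorCoact hP ρ.coact τ.coact⟩
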